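/- Let $F(a,b;c;x)$ denote the Gauss hypergeometric function ${}_2F_1$, and let $0<\kappa<1$. The map $T\mapsto\int_0^T F(\tfrac13,\tfrac23;\tfrac12;\kappa^2\sin^2 t)\,dt$ is a strictly increasing surjection $\mathbb R\to\mathbb R$ whose inverse $\phi$ is differentiable. Put $\delta_\kappa=\phi'$. Then $\delta_\kappa$ has a unique meromorphic extension $\mathrm{dn}_3$ to $\mathbb C$, which is elliptic. There is also a unique Weierstrass function $p_\kappa=\wp(\bullet;g_2,g_3)$ with invariants $$g_2=\tfrac{4}{27}(9-8\kappa^2),\qquad g_3=\tfrac{8}{729}(27-36\kappa^2+8\kappa^4).$$ Both $\mathrm{dn}_3$ and $p_\kappa$ have exactly one fundamental pair of periods $(2\omega_\kappa,2\omega_\kappa')$ (that is, a pair such that the periods of the function are precisely the numbers $2m\omega_\kappa+2n\omega_\kappa'$ with $m,n\in\mathbb Z$) for which $\omega_\kappa>0$ and $-i\omega_\kappa'>0$. For both functions it is given by $$\omega_\kappa=\tfrac12\pi\,F(\tfrac13,\tfrac23;1;\kappa^2),\qquad \omega_\kappa'=i\,\tfrac{\sqrt3}{2}\,\pi\,F(\tfrac13,\tfrac23;1;1-\kappa^2).$$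 Hence the period ratio is $$\frac{\omega_\kappa'}{\omega_\kappa}=i\sqrt3\,\frac{F(\tfrac13,\tfrac23;1;1-\kappa^2)}{F(\tfrac13,\tfrac23;1;\kappa^2)}.$$ -/

import Mathlib

/-- The incomplete hypergeometric integral `T ↦ ∫₀ᵀ F(1/3, 2/3; 1/2; κ² sin² t) dt`. -/
noncomputable def shenIntegral (κ T : ℝ) : ℝ :=
  ∫ t in (0 : ℝ)..T, ₂F₁ (1 / 3 : ℝ) (2 / 3 : ℝ) (1 / 2 : ℝ) (κ ^ 2 * Real.sin t ^ 2 : ℝ)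

/-- The function `φ`, inverse to `shenIntegral κ`. -/
noncomputable def shenPhi (κ : ℝ) : ℝ → ℝ :=
  Function.invFun (shenIntegral κ)

/-- The real function `δ_κ = φ'`. -/
noncomputable def shenDelta (κ : ℝ) : ℝ → ℝ :=
  deriv (shenPhi κ)

/-- `D` is the function `dn₃` of modulus `κ`: the meromorphic function on the whole plane whose
restriction to the real line is `δ_κ`. Normal form means that `D` has no removable singularities
and takes the conventional value `0` at each of its poles. -/
def IsShenDn3 (κ : ℝ) (D : ℂ → ℂ) : Prop :=
  MeromorphicNFOn D Set.univ ∧ ∀ x : ℝ, D (x : ℂ) = (shenDelta κ x : ℂ)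

/-- `p` is the Weierstrass function `p_κ = ℘(•; g₂, g₃)` with invariants
`g₂ = (4/27)(9 - 8κ²)` and `g₃ = (8/729)(27 - 36κ² + 8κ⁴)`. -/
def IsShenP (κ : ℝ) (p : ℂ → ℂ) : Prop :=
  ∃ L : PeriodPair,
    L.g₂ = 4 / 27 * (9 - 8 * (κ : ℂ) ^ 2) ∧
    L.g₃ = 8 / 729 * (27 - 36 * (κ : ℂ) ^ 2 + 8 * (κ : ℂ) ^ 4) ∧
    p = L.weierstrassP

/-- `(2ω, 2ω')` is the fundamental pair of periods of `f` for which `ω` and `-iω'` are strictly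
positive: the periods of `f` are exactly the integral combinations of `2ω` and `2ω'`. -/
def IsFundamentalHalfPeriods (f : ℂ → ℂ) (ω ω' : ℂ) : Prop :=
  (0 < ω.re ∧ ω.im = 0) ∧ (ω'.re = 0 ∧ 0 < ω'.im) ∧
    ∀ w : ℂ, Function.Periodic f w ↔ ∃ m n : ℤ, w = m * (2 * ω) + n * (2 * ω')

/-! The proof builds one rectangular lattice whose sides are real hypergeometric integrals, and
shows that both functions live on it.

Since `F(1/3,2/3;1/2;sin²ψ) = cos(ψ/3)/cos ψ` (`hypergeometric_one_third_sin_sq`), the substitution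
`sin ψ = m cos t` makes the integrand `cos φ / cos 3φ` with `φ = -ψ/3`. Its reciprocal is `4cos²φ -
3`. Hence `δ_κ(u) = X(u - p/2)`, where `X'² = f(X)` for a quartic `f` with roots `1` and `e`, and
`4κ² = (1-e)(e+2)²`. Replacing `φ` by `π/6 - ψ/3` and `κ` by `√(1-κ²)` gives a second motion with
`Y'² = -f(Y)`, on the adjacent interval below the same root `e` (`isOrbitPair`). Termwise
integration turns the lower parameter `1/2` into `1`, so the period `p` of `X` and the period `q` of
`Y` are values of `F(1/3,2/3;1;·)` (`orbitTime_zero_pi`, `orbitTime_pi_div_six_two_pi`).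

The real motions are glued by Klein's formula: with `F` the polarization of `f`, the function
`W(u+iv) = (F(X,Y) + iX'Y') / (2(X-Y)²)` satisfies Cauchy–Riemann (`differentiableAt_kleinSum`). It
is even, has periods `p` and `iq`, is regular off their lattice because `X ≥ e ≥ Y`, and satisfies
`z²W → 1` at `0`. By Liouville, `W = ℘ + c`. On `Re z = p/2`, where `X = 1`, the function `W` is an
explicit Möbius function of `Y`; comparing differential equations there gives `c = 0` and the
required invariants (`invariants`).

On the real axis `Y = e`, so `℘` is a Möbius function of `X`. Translation by `p/2` acts on `X` by a
Möbius involution (`X_sub_half`), so `dn₃ = 1 - (4κ²/9)/(℘ + 1/3)`. A nonconstant Möbius function of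
`℘` has exactly the periods of `℘`. Uniqueness comes from the identity theorem for `dn₃`, and from
the Laurent expansion at `0` for `℘` with given invariants. -/

/-! ### Power series and the hypergeometric differential equation. -/

/-- For `r < s < 1` the terms `|a n| s ^ n` are bounded, and `(n + 1) (r / s) ^ n` is summable. The
conclusion has the form of the hypothesis, so differentiation can be iterated. -/
theorem summable_succ_mul_of_summable_mul_pow {a : ℕ → ℝ}
    (ha : ∀ r : ℝ, 0 ≤ r → r < 1 → Summable fun n ↦ |a n| * r ^ n) (r : ℝ) (hr₀ : 0 ≤ r)
    (hr₁ : r < 1) : Summable fun n : ℕ ↦ |(n + 1 : ℝ) * a (n + 1)| * r ^ n := by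
  obtain ⟨s, hrs, hs⟩ := exists_between hr₁
  have hs0 : 0 < s := hr₀.trans_lt hrs
  obtain ⟨C, hC⟩ := (ha s hs0.le hs).tendsto_atTop_zero.bddAbove_range
  have hq : ‖r / s‖ < 1 := by
    rw [Real.norm_of_nonneg (by positivity), div_lt_one hs0]; exact hrs
  have h1 := (summable_pow_mul_geometric_of_norm_lt_one 1 hq).add
    (summable_geometric_of_norm_lt_one hq)
  refine Summable.of_nonneg_of_le (fun n ↦ by positivity) (fun n ↦ ?_) (h1.mul_left (C / s))
  have h2 : |a (n + 1)| * s ^ (n + 1) ≤ C := hC ⟨n + 1, rfl⟩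
  have h3 : |a (n + 1)| * s ^ n ≤ C / s := by
    rwa [le_div_iff₀ hs0, mul_assoc, ← pow_succ]
  have h4 : r ^ n = s ^ n * (r / s) ^ n := by rw [div_pow]; field_simp
  rw [abs_mul, abs_of_nonneg (by positivity : (0 : ℝ) ≤ n + 1), h4]
  have h5 : 0 ≤ (n + 1 : ℝ) * (r / s) ^ n := by positivity
  calc (n + 1 : ℝ) * |a (n + 1)| * (s ^ n * (r / s) ^ n)
      = |a (n + 1)| * s ^ n * ((n + 1 : ℝ) * (r / s) ^ n) := by ring
    _ ≤ C / s * ((n + 1 : ℝ) * (r / s) ^ n) := mul_le_mul_of_nonneg_right h3 h5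
    _ = _ := by ring

theorem summable_mul_pow_of_abs_lt {a : ℕ → ℝ}
    (ha : ∀ r : ℝ, 0 ≤ r → r < 1 → Summable fun n ↦ |a n| * r ^ n) {x : ℝ} (hx : |x| < 1) :
    Summable fun n ↦ a n * x ^ n := by
  refine Summable.of_norm ?_
  simpa [abs_mul, abs_pow] using ha |x| (abs_nonneg x) hx

theorem hasDerivAt_tsum_mul_pow {a : ℕ → ℝ}
    (ha : ∀ r : ℝ, 0 ≤ r → r < 1 → Summable fun n ↦ |a n| * r ^ n) {x : ℝ} (hx : |x| < 1) :
    HasDerivAt (fun x : ℝ ↦ ∑' n, a n * x ^ n) (∑' n : ℕ, ((n + 1 : ℝ) * a (n + 1)) * x ^ n) x := by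
  obtain ⟨r, hxr, hr⟩ := exists_between hx
  have hr0 : 0 < r := (abs_nonneg x).trans_lt hxr
  have hs := summable_succ_mul_of_summable_mul_pow ha r hr0.le hr
  have hu : Summable fun n : ℕ ↦ |a n * n| * r ^ (n - 1) := by
    rw [← summable_nat_add_iff 1]
    refine hs.congr fun n ↦ ?_
    push_cast
    simp [mul_comm]
  have key := hasDerivAt_tsum_of_isPreconnected (u := fun n : ℕ ↦ |a n * n| * r ^ (n - 1))
    (g := fun n x ↦ a n * x ^ n) (g' := fun n x ↦ a n * (n * x ^ (n - 1)))
    (t := Metric.ball (0 : ℝ) r) hu Metric.isOpen_ball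
    (convex_ball (0 : ℝ) r).isPreconnected (fun n y _ ↦ (hasDerivAt_pow n y).const_mul (a n))
    (fun n y hy ↦ ?_) (y₀ := 0) (by simpa using hr0)
    (summable_mul_pow_of_abs_lt ha (by simp)) (y := x) (by simpa using hxr)
  · refine key.congr_deriv ?_
    rw [Summable.tsum_eq_zero_add (f := fun n : ℕ ↦ a n * (n * x ^ (n - 1)))]
    · simp only [CharP.cast_eq_zero, zero_mul, mul_zero, zero_add, Nat.add_sub_cancel]
      refine tsum_congr fun n ↦ ?_
      push_cast
      ring
    · rw [← summable_nat_add_iff 1]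
      refine (summable_mul_pow_of_abs_lt
        (summable_succ_mul_of_summable_mul_pow ha) hx).congr fun n ↦ ?_
      simp only [Nat.add_sub_cancel]
      push_cast
      ring
  · rw [← mul_assoc, norm_mul, norm_pow, Real.norm_eq_abs, Real.norm_eq_abs]
    have : |y| ≤ r := by simpa using (Metric.mem_ball.1 hy).le
    gcongr

theorem ordinaryHypergeometric_real_eq_tsum (a b c x : ℝ) :
    ₂F₁ a b c x = ∑' n, ordinaryHypergeometricCoefficient a b c n * x ^ n := by
  rw [ordinaryHypergeometric_eq_tsum]
  rfl

theorem ordinaryHypergeometricCoefficient_succ {a b c : ℝ} (hc : 0 < c) (n : ℕ) :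
    (n + 1 : ℝ) * (n + c) * ordinaryHypergeometricCoefficient a b c (n + 1) =
      (n + a) * (n + b) * ordinaryHypergeometricCoefficient a b c n := by
  have h1 : (Polynomial.eval c (ascPochhammer ℝ n)) ≠ 0 := (ascPochhammer_pos n c hc).ne'
  have h2 : c + n ≠ 0 := by positivity
  have h3 : (n.factorial : ℝ) ≠ 0 := by positivity
  simp only [ordinaryHypergeometricCoefficient, ascPochhammer_succ_eval, Nat.factorial_succ]
  push_cast
  field_simp
  ring

theorem summable_ordinaryHypergeometricCoefficient {a b c : ℝ} (ha : 0 < a) (hb : 0 < b)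
    (hc : 0 < c) (r : ℝ) (hr₀ : 0 ≤ r) (hr₁ : r < 1) :
    Summable fun n ↦ |ordinaryHypergeometricCoefficient a b c n| * r ^ n := by
  have hrad := ordinaryHypergeometricSeries_radius_eq_one ℝ a b c (fun n ↦ by
    have : (0 : ℝ) ≤ n := by positivity
    exact ⟨by linarith, by linarith, by linarith⟩)
  have hs := (ordinaryHypergeometricSeries ℝ a b c).summable_norm_apply (x := r) (by
    rw [hrad]
    simpa [← ENNReal.ofReal_one, Metric.eball_ofReal, abs_of_nonneg hr₀] using hr₁)
  refine hs.congr fun n ↦ ?_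
  rw [ordinaryHypergeometricSeries_apply_eq, smul_eq_mul, norm_mul, norm_pow,
    Real.norm_of_nonneg hr₀]
  rfl

theorem hasSum_mul_pow_of_shift {b : ℕ → ℝ} {S x : ℝ} (h0 : b 0 = 0)
    (h : HasSum (fun n ↦ b (n + 1) * x ^ n) S) : HasSum (fun n ↦ b n * x ^ n) (x * S) := by
  rw [← hasSum_nat_add_iff' 1]
  convert! h.mul_left x using 1
  · ext n
    ring
  · simp [h0]

/-- The coefficient of `x ^ n` on the left is the two-term recurrence of the hypergeometric
coefficients. -/
theorem hypergeometric_ode {a b c : ℝ} (ha : 0 < a) (hb : 0 < b) (hc : 0 < c) :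
    ∃ F₁ F₂ : ℝ → ℝ, (∀ x, |x| < 1 → HasDerivAt (₂F₁ a b c : ℝ → ℝ) (F₁ x) x) ∧
      (∀ x, |x| < 1 → HasDerivAt F₁ (F₂ x) x) ∧
      ∀ x, |x| < 1 → x * (1 - x) * F₂ x + (c - (a + b + 1) * x) * F₁ x - a * b * ₂F₁ a b c x = 0 := by
  obtain ⟨A, hA⟩ : ∃ A, A = ordinaryHypergeometricCoefficient a b c := ⟨_, rfl⟩
  have h0 : ∀ r : ℝ, 0 ≤ r → r < 1 → Summable fun n ↦ |A n| * r ^ n := hA ▸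
    summable_ordinaryHypergeometricCoefficient ha hb hc
  have h1 := summable_succ_mul_of_summable_mul_pow h0
  have h2 := summable_succ_mul_of_summable_mul_pow h1
  have hF : (₂F₁ a b c : ℝ → ℝ) = fun x ↦ ∑' n, A n * x ^ n :=
    hA ▸ funext fun x ↦ ordinaryHypergeometric_real_eq_tsum a b c x
  refine ⟨fun x ↦ ∑' n : ℕ, ((n + 1 : ℝ) * A (n + 1)) * x ^ n,
    fun x ↦ ∑' n : ℕ, ((n + 1 : ℝ) * (((n + 1 : ℕ) + 1 : ℝ) * A (n + 1 + 1))) * x ^ n,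
    fun x hx ↦ ?_, fun x hx ↦ ?_, fun x hx ↦ ?_⟩
  · rw [hF]; exact hasDerivAt_tsum_mul_pow h0 hx
  · exact hasDerivAt_tsum_mul_pow h1 hx
  · simp only [hF]
    have s0 := (summable_mul_pow_of_abs_lt h0 hx).hasSum
    have s1 := (summable_mul_pow_of_abs_lt h1 hx).hasSum
    have s2 := (summable_mul_pow_of_abs_lt h2 hx).hasSum
    have t1 : HasSum (fun n : ℕ ↦ ((n : ℝ) * A n) * x ^ n)
        (x * ∑' n : ℕ, ((n + 1 : ℝ) * A (n + 1)) * x ^ n) := by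
      refine hasSum_mul_pow_of_shift (b := fun n : ℕ ↦ n * A n) (by simp) ?_
      simpa using s1
    have t2 : HasSum (fun n : ℕ ↦ (n * ((n + 1 : ℝ) * A (n + 1))) * x ^ n)
        (x * ∑' n : ℕ, ((n + 1 : ℝ) * (((n + 1 : ℕ) + 1 : ℝ) * A (n + 1 + 1))) * x ^ n) := by
      refine hasSum_mul_pow_of_shift (b := fun n : ℕ ↦ n * ((n + 1 : ℝ) * A (n + 1))) (by simp) ?_
      simpa using s2
    have t3 : HasSum (fun n : ℕ ↦ (n * ((n - 1 : ℝ) * A n)) * x ^ n)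
        (x * (x * ∑' n : ℕ, ((n + 1 : ℝ) * (((n + 1 : ℕ) + 1 : ℝ) * A (n + 1 + 1))) * x ^ n)) := by
      refine hasSum_mul_pow_of_shift (b := fun n : ℕ ↦ n * ((n - 1 : ℝ) * A n)) (by simp) ?_
      convert! t2 using 2 with n
      push_cast; ring
    have := ((((t2.sub t3).add (s1.mul_left c)).sub (t1.mul_left (a + b + 1))).sub
      (s0.mul_left (a * b)))
    have e := this.unique (a₂ := 0) (by
      convert! (hasSum_zero : HasSum (fun _ : ℕ ↦ (0 : ℝ)) 0) using 2 with n
      have := ordinaryHypergeometricCoefficient_succ (a := a) (b := b) hc n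
      rw [← hA] at this
      linear_combination x ^ n * this)
    linear_combination e

/-! ### Trigonometric evaluation of the integrand, and its mean value. -/

/-- Rotating `(k g, g₁)` by the angle `k x` yields two first integrals, `e1` and `e2`; solving them
for `g` gives the cosine. -/
theorem eqOn_of_hasDerivAt_harmonic {k r : ℝ} (hk : k ≠ 0) {g g₁ : ℝ → ℝ}
    (h : ∀ x ∈ Set.Ioo (-r) r, HasDerivAt g (g₁ x) x)
    (h₁ : ∀ x ∈ Set.Ioo (-r) r, HasDerivAt g₁ (-k ^ 2 * g x) x) (h0 : g 0 = 1) (h10 : g₁ 0 = 0)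
    {x : ℝ} (hx : x ∈ Set.Ioo (-r) r) : g x = Real.cos (k * x) := by
  have hr : (0 : ℝ) ∈ Set.Ioo (-r) r := by
    constructor <;> linarith [hx.1, hx.2]
  have hc : ∀ x, HasDerivAt (fun x ↦ Real.cos (k * x)) (-Real.sin (k * x) * k) x := fun x ↦
    ((hasDerivAt_id x).const_mul k).cos.congr_deriv (by simp)
  have hs : ∀ x, HasDerivAt (fun x ↦ Real.sin (k * x)) (Real.cos (k * x) * k) x := fun x ↦
    ((hasDerivAt_id x).const_mul k).sin.congr_deriv (by simp)
  have key : ∀ G : ℝ → ℝ, (∀ y ∈ Set.Ioo (-r) r, HasDerivAt G 0 y) → G x = G 0 := fun G hG ↦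
    (convex_Ioo (-r) r).is_const_of_fderivWithin_eq_zero (𝕜 := ℝ)
      (fun y hy ↦ (hG y hy).differentiableAt.differentiableWithinAt)
      (fun y hy ↦ by
        rw [fderivWithin_of_isOpen isOpen_Ioo hy, (hG y hy).hasFDerivAt.fderiv]
        ext; simp) hx hr
  have e1 := key (fun y ↦ k * g y * Real.cos (k * y) - g₁ y * Real.sin (k * y)) fun y hy ↦
    ((((h y hy).const_mul k).mul (hc y)).sub ((h₁ y hy).mul (hs y))).congr_deriv (by ring)
  have e2 := key (fun y ↦ k * g y * Real.sin (k * y) + g₁ y * Real.cos (k * y)) fun y hy ↦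
    ((((h y hy).const_mul k).mul (hs y)).add ((h₁ y hy).mul (hc y))).congr_deriv (by ring)
  simp only [h0, h10, mul_zero, Real.cos_zero, Real.sin_zero] at e1 e2
  have := Real.sin_sq_add_cos_sq (k * x)
  apply mul_left_cancel₀ hk
  linear_combination Real.cos (k * x) * e1 + Real.sin (k * x) * e2 - k * g x * this

theorem sin_sq_lt_one {x : ℝ} (hx : x ∈ Set.Ioo (-(Real.pi / 2)) (Real.pi / 2)) :
    |Real.sin x ^ 2| < 1 := by
  rw [abs_of_nonneg (sq_nonneg _)]
  have := Real.cos_pos_of_mem_Ioo hx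
  nlinarith [Real.sin_sq_add_cos_sq x]

/-- Under `z = sin² x` the hypergeometric equation says that `F(sin² x) cos x` satisfies `g'' =
-g/9`. -/
theorem hypergeometric_one_third_sin_sq {x : ℝ}
    (hx : x ∈ Set.Ioo (-(Real.pi / 2)) (Real.pi / 2)) :
    ₂F₁ (1 / 3 : ℝ) (2 / 3 : ℝ) (1 / 2 : ℝ) (Real.sin x ^ 2) = Real.cos (x / 3) / Real.cos x := by
  obtain ⟨F₁, F₂, hF, hF₁, hode⟩ := hypergeometric_ode (a := 1 / 3) (b := 2 / 3) (c := 1 / 2)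
    (by norm_num) (by norm_num) (by norm_num)
  set F : ℝ → ℝ := ₂F₁ (1 / 3 : ℝ) (2 / 3 : ℝ) (1 / 2 : ℝ) with hFdef
  have hsq : ∀ y, HasDerivAt (fun y ↦ Real.sin y ^ 2) (2 * Real.sin y * Real.cos y) y := fun y ↦
    ((Real.hasDerivAt_sin y).pow 2).congr_deriv (by simp)
  have hcF : ∀ y ∈ Set.Ioo (-(Real.pi / 2)) (Real.pi / 2),
      HasDerivAt (fun y ↦ F (Real.sin y ^ 2)) (F₁ (Real.sin y ^ 2) * (2 * Real.sin y * Real.cos y))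
        y := fun y hy ↦
    HasDerivAt.comp y (hF _ (sin_sq_lt_one hy)) (hsq y)
  have hcF₁ : ∀ y ∈ Set.Ioo (-(Real.pi / 2)) (Real.pi / 2),
      HasDerivAt (fun y ↦ F₁ (Real.sin y ^ 2)) (F₂ (Real.sin y ^ 2) * (2 * Real.sin y * Real.cos y))
        y := fun y hy ↦
    HasDerivAt.comp y (hF₁ _ (sin_sq_lt_one hy)) (hsq y)
  have hcos := Real.cos_pos_of_mem_Ioo hx
  have := eqOn_of_hasDerivAt_harmonic (k := 1 / 3) (r := Real.pi / 2) (by norm_num)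
    (g := fun y ↦ F (Real.sin y ^ 2) * Real.cos y)
    (g₁ := fun y ↦ F₁ (Real.sin y ^ 2) * (2 * Real.sin y * Real.cos y) * Real.cos y +
      F (Real.sin y ^ 2) * (-Real.sin y))
    (fun y hy ↦ (hcF y hy).mul (Real.hasDerivAt_cos y))
    (fun y hy ↦ by
      refine ((((hcF₁ y hy).mul (((Real.hasDerivAt_sin y).const_mul 2).mul
        (Real.hasDerivAt_cos y))).mul (Real.hasDerivAt_cos y)).add
        ((hcF y hy).mul (Real.hasDerivAt_sin y).neg)).congr_deriv ?_
      have h1 := hode _ (sin_sq_lt_one hy)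
      have h2 := Real.sin_sq_add_cos_sq y
      simp only [Pi.mul_apply, Pi.neg_apply]
      have h3 : Real.sin y ^ 2 = 1 - Real.cos y ^ 2 := by linarith
      generalize F (Real.sin y ^ 2) = f0 at h1 ⊢
      generalize F₁ (Real.sin y ^ 2) = f1 at h1 ⊢
      generalize F₂ (Real.sin y ^ 2) = f2 at h1 ⊢
      generalize Real.sin y = s at *
      generalize Real.cos y = c at *
      have h4 : c ^ 2 = 1 - s ^ 2 := by linarith
      linear_combination 4 * c * h1 + (4 * c * s ^ 2 * f2 + 2 * c * f1) * h4)
    (by simp [hFdef]) (by simp) hx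
  rw [eq_div_iff hcos.ne', this]
  congr 1
  ring

theorem integral_ordinaryHypergeometric_sin_sq {a b m : ℝ} (ha : 0 < a) (hb : 0 < b)
    (hm₀ : 0 ≤ m) (hm₁ : m < 1) :
    ∫ t in (0 : ℝ)..Real.pi, ₂F₁ a b (1 / 2 : ℝ) (m ^ 2 * Real.sin t ^ 2) =
      Real.pi * ₂F₁ a b (1 : ℝ) (m ^ 2) := by
  have hm2 : m ^ 2 < 1 := by nlinarith
  have hs := summable_ordinaryHypergeometricCoefficient ha hb (by norm_num : (0 : ℝ) < 1 / 2)
    (m ^ 2) (by positivity) hm2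
  have hpt : ∀ t : ℝ, |m ^ 2 * Real.sin t ^ 2| < 1 := fun t ↦ by
    rw [abs_of_nonneg (by positivity)]
    nlinarith [Real.sin_sq_le_one t, sq_nonneg m]
  have key := intervalIntegral.hasSum_integral_of_dominated_convergence (a := 0) (b := Real.pi)
    (μ := MeasureTheory.volume)
    (F := fun n t ↦ ordinaryHypergeometricCoefficient a b (1 / 2) n * (m ^ 2 * Real.sin t ^ 2) ^ n)
    (f := fun t ↦ ₂F₁ a b (1 / 2 : ℝ) (m ^ 2 * Real.sin t ^ 2))
    (fun n _ ↦ |ordinaryHypergeometricCoefficient a b (1 / 2) n| * (m ^ 2) ^ n)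
    (fun n ↦ by
      refine Continuous.aestronglyMeasurable ?_
      fun_prop)
    (fun n ↦ .of_forall fun t _ ↦ by
      rw [norm_mul, norm_pow, Real.norm_eq_abs, Real.norm_of_nonneg (by positivity)]
      gcongr
      nlinarith [Real.sin_sq_le_one t, sq_nonneg m])
    (.of_forall fun t _ ↦ hs) (by simp)
    (.of_forall fun t _ ↦ by
      rw [ordinaryHypergeometric_real_eq_tsum]
      exact (summable_mul_pow_of_abs_lt (summable_ordinaryHypergeometricCoefficient ha hb
        (by norm_num)) (hpt t)).hasSum)
  have hs1 := (summable_mul_pow_of_abs_lt (summable_ordinaryHypergeometricCoefficient ha hb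
    one_pos) (x := m ^ 2) (by rwa [abs_of_nonneg (by positivity)])).hasSum.mul_left Real.pi
  rw [ordinaryHypergeometric_real_eq_tsum]
  refine key.unique ?_
  convert! hs1 using 2 with n
  rw [show (fun t : ℝ ↦ ordinaryHypergeometricCoefficient a b (1 / 2) n *
    (m ^ 2 * Real.sin t ^ 2) ^ n) = fun t ↦ ordinaryHypergeometricCoefficient a b (1 / 2) n *
    (m ^ 2) ^ n * Real.sin t ^ (2 * n) from funext fun t ↦ by ring,
    intervalIntegral.integral_const_mul, integral_sin_pow_even]
  -- The Wallis product is `(1/2)ₙ / (1)ₙ`, so integrating `sin ^ (2n)` replaces the lower parameter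
  -- `1/2` by `1`.
  have hp : ∀ n : ℕ, Polynomial.eval (1 / 2 : ℝ) (ascPochhammer ℝ n) =
      Polynomial.eval (1 : ℝ) (ascPochhammer ℝ n) *
        ∏ i ∈ Finset.range n, (2 * (i : ℝ) + 1) / (2 * i + 2) := by
    intro n
    induction n with
    | zero => simp
    | succ n ih =>
      rw [Finset.prod_range_succ, ascPochhammer_succ_eval, ascPochhammer_succ_eval, ih]
      have : (2 * (n : ℝ) + 2) ≠ 0 := by positivity
      field_simp
      ring
  have h1 := (ascPochhammer_pos n (1 : ℝ) one_pos).ne'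
  have h2 := (ascPochhammer_pos n (1 / 2 : ℝ) (by norm_num)).ne'
  unfold ordinaryHypergeometricCoefficient
  rw [hp] at h2 ⊢
  have h3 := right_ne_zero_of_mul h2
  field_simp

/-! ### Inverting the primitive of a positive function. -/

theorem strictMono_integral_of_pos {h : ℝ → ℝ} (hc : Continuous h) (hpos : ∀ t, 0 < h t) :
    StrictMono fun T : ℝ ↦ ∫ t in (0 : ℝ)..T, h t := by
  refine strictMono_of_deriv_pos fun x ↦ ?_
  rw [hc.deriv_integral h 0 x]
  exact hpos x

theorem surjective_integral_of_le {h : ℝ → ℝ} (hc : Continuous h) {c : ℝ} (hc0 : 0 < c)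
    (hle : ∀ t, c ≤ h t) : Function.Surjective fun T : ℝ ↦ ∫ t in (0 : ℝ)..T, h t := by
  have hcont : Continuous fun T : ℝ ↦ ∫ t in (0 : ℝ)..T, h t :=
    intervalIntegral.continuous_primitive (fun a b ↦ hc.intervalIntegrable a b) 0
  refine hcont.surjective ?_ ?_
  · refine Filter.tendsto_atTop_mono' _ ?_ (Filter.tendsto_id.const_mul_atTop hc0)
    filter_upwards [Filter.eventually_ge_atTop 0] with T hT
    have := intervalIntegral.integral_mono_on hT (μ := MeasureTheory.volume) (f := fun _ ↦ c)
      intervalIntegrable_const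
      (hc.intervalIntegrable 0 T) fun x _ ↦ hle x
    simpa [mul_comm] using this
  · refine Filter.tendsto_atBot_mono' _ ?_ (Filter.tendsto_id.const_mul_atBot hc0)
    filter_upwards [Filter.eventually_le_atBot 0] with T hT
    have := intervalIntegral.integral_mono_on hT (μ := MeasureTheory.volume) (f := fun _ ↦ c)
      intervalIntegrable_const
      (hc.intervalIntegrable T 0) fun x _ ↦ hle x
    rw [intervalIntegral.integral_symm]
    simp at this ⊢
    linarith

/-- The inverse is monotone and surjective, hence continuous, which is what the inverse function
rule needs. -/
theorem hasDerivAt_rightInverse_integral {h φ : ℝ → ℝ} (hc : Continuous h) (hpos : ∀ t, 0 < h t)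
    (hφ : Function.RightInverse φ fun T : ℝ ↦ ∫ t in (0 : ℝ)..T, h t) (u : ℝ) :
    HasDerivAt φ (h (φ u))⁻¹ u := by
  have hm := strictMono_integral_of_pos hc hpos
  have hφm : StrictMono φ := fun x y hxy ↦ by
    rw [← hm.lt_iff_lt]
    simpa only [hφ x, hφ y] using hxy
  have hφs : Function.Surjective φ := fun t ↦ ⟨_, hm.injective (hφ _)⟩
  have hcont : Continuous φ := hφm.monotone.continuous_of_surjective hφs
  exact HasDerivAt.of_local_left_inverse hcont.continuousAt
    (hc.integral_hasStrictDerivAt 0 (φ u)).hasDerivAt (hpos _).ne' (.of_forall hφ)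

/-! ### The motions parametrized by phase. -/

/-- The angle `a - ψ / 3`, where `sin ψ = m cos t`. -/
noncomputable def orbitAngle (a m t : ℝ) : ℝ :=
  a - Real.arcsin (m * Real.cos t) / 3

/-- The time density along the orbit, in terms of the phase `t`. -/
noncomputable def orbitDensity (a m t : ℝ) : ℝ :=
  Real.cos (orbitAngle a m t) / Real.cos (Real.arcsin (m * Real.cos t))

/-- The time at which the orbit has phase `T`. -/
noncomputable def orbitTime (a m T : ℝ) : ℝ :=
  ∫ t in (0 : ℝ)..T, orbitDensity a m t

/-- The phase of the orbit at time `u`. -/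
noncomputable def orbitPhase (a m : ℝ) : ℝ → ℝ :=
  Function.invFun (orbitTime a m)

/-- The position of the orbit at time `u`. -/
noncomputable def orbitValue (a m u : ℝ) : ℝ :=
  4 * Real.cos (orbitAngle a m (orbitPhase a m u)) ^ 2 - 3

/-- The velocity of the orbit at time `u`. -/
noncomputable def orbitVelocity (a m u : ℝ) : ℝ :=
  -(8 / 3) * m * (Real.sin (orbitAngle a m (orbitPhase a m u)) * Real.sin (orbitPhase a m u))

section Orbit

theorem abs_mul_cos_lt_one {m : ℝ} (hm₀ : 0 < m) (hm₁ : m < 1) (t : ℝ) :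
    -1 < m * Real.cos t ∧ m * Real.cos t < 1 := by
  have := Real.cos_le_one t
  have := Real.neg_one_le_cos t
  constructor <;> nlinarith

theorem arcsin_mem_Ioo {x : ℝ} (hx : -1 < x ∧ x < 1) :
    Real.arcsin x ∈ Set.Ioo (-(Real.pi / 2)) (Real.pi / 2) :=
  ⟨Real.neg_pi_div_two_lt_arcsin.2 hx.1, Real.arcsin_lt_pi_div_two.2 hx.2⟩

variable {a m : ℝ}

theorem cos_arcsin_mul_cos_pos (hm₀ : 0 < m) (hm₁ : m < 1) (t : ℝ) :
    0 < Real.cos (Real.arcsin (m * Real.cos t)) :=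
  Real.cos_pos_of_mem_Ioo (arcsin_mem_Ioo (abs_mul_cos_lt_one hm₀ hm₁ t))

/-- The range of `a` covers both motions used, `a = 0` and `a = π/6`. The bound `π/3` keeps the
cosine of the angle at least `1/2`, which makes time an invertible function of phase. -/
theorem orbitAngle_mem (ha₀ : 0 ≤ a) (ha₁ : a ≤ Real.pi / 6) (hm₀ : 0 < m) (hm₁ : m < 1) (t : ℝ) :
    orbitAngle a m t ∈ Set.Ioo (-(Real.pi / 3)) (Real.pi / 3) := by
  have := arcsin_mem_Ioo (abs_mul_cos_lt_one hm₀ hm₁ t)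
  unfold orbitAngle
  constructor <;> linarith [this.1, this.2, Real.pi_pos]

theorem cos_orbitAngle_ge (ha₀ : 0 ≤ a) (ha₁ : a ≤ Real.pi / 6) (hm₀ : 0 < m) (hm₁ : m < 1)
    (t : ℝ) : 1 / 2 ≤ Real.cos (orbitAngle a m t) := by
  have h := orbitAngle_mem ha₀ ha₁ hm₀ hm₁ t
  rw [← Real.cos_pi_div_three, ← Real.cos_abs (orbitAngle a m t)]
  exact Real.cos_le_cos_of_nonneg_of_le_pi (abs_nonneg _) (by linarith [Real.pi_pos])
    (abs_le.2 ⟨h.1.le, h.2.le⟩)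

theorem orbitDensity_ge (ha₀ : 0 ≤ a) (ha₁ : a ≤ Real.pi / 6) (hm₀ : 0 < m) (hm₁ : m < 1)
    (t : ℝ) : 1 / 2 ≤ orbitDensity a m t := by
  have h := cos_orbitAngle_ge ha₀ ha₁ hm₀ hm₁ t
  have h2 := cos_arcsin_mul_cos_pos hm₀ hm₁ t
  rw [orbitDensity, le_div_iff₀ h2]
  linarith [Real.cos_le_one (Real.arcsin (m * Real.cos t))]

theorem continuous_orbitDensity (hm₀ : 0 < m) (hm₁ : m < 1) :
    Continuous (orbitDensity a m) := by
  unfold orbitDensity orbitAngle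
  refine Continuous.div (by fun_prop) (by fun_prop) fun t ↦ (cos_arcsin_mul_cos_pos hm₀ hm₁ t).ne'

theorem hasDerivAt_orbitAngle (hm₀ : 0 < m) (hm₁ : m < 1) (t : ℝ) :
    HasDerivAt (orbitAngle a m)
      (m * Real.sin t / (3 * Real.cos (Real.arcsin (m * Real.cos t)))) t := by
  have h := abs_mul_cos_lt_one hm₀ hm₁ t
  have h1 := (Real.hasDerivAt_arcsin h.1.ne' h.2.ne).comp t ((Real.hasDerivAt_cos t).const_mul m)
  refine ((h1.div_const 3).const_sub a).congr_deriv ?_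
  rw [Real.cos_arcsin]
  have : √(1 - (m * Real.cos t) ^ 2) ≠ 0 := by
    have := cos_arcsin_mul_cos_pos hm₀ hm₁ t
    rw [Real.cos_arcsin] at this
    exact this.ne'
  field_simp

theorem strictMono_orbitTime (ha₀ : 0 ≤ a) (ha₁ : a ≤ Real.pi / 6) (hm₀ : 0 < m) (hm₁ : m < 1) :
    StrictMono (orbitTime a m) :=
  strictMono_integral_of_pos (continuous_orbitDensity hm₀ hm₁) fun t ↦
    one_half_pos.trans_le (orbitDensity_ge ha₀ ha₁ hm₀ hm₁ t)

theorem orbitTime_orbitPhase (ha₀ : 0 ≤ a) (ha₁ : a ≤ Real.pi / 6) (hm₀ : 0 < m) (hm₁ : m < 1)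
    (u : ℝ) : orbitTime a m (orbitPhase a m u) = u :=
  Function.rightInverse_invFun (surjective_integral_of_le (continuous_orbitDensity hm₀ hm₁)
    one_half_pos (orbitDensity_ge ha₀ ha₁ hm₀ hm₁)) u

theorem orbitPhase_orbitTime (ha₀ : 0 ≤ a) (ha₁ : a ≤ Real.pi / 6) (hm₀ : 0 < m) (hm₁ : m < 1)
    (t : ℝ) : orbitPhase a m (orbitTime a m t) = t :=
  Function.leftInverse_invFun (strictMono_orbitTime ha₀ ha₁ hm₀ hm₁).injective t

theorem hasDerivAt_orbitPhase (ha₀ : 0 ≤ a) (ha₁ : a ≤ Real.pi / 6) (hm₀ : 0 < m) (hm₁ : m < 1)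
    (u : ℝ) : HasDerivAt (orbitPhase a m) (orbitDensity a m (orbitPhase a m u))⁻¹ u :=
  hasDerivAt_rightInverse_integral (continuous_orbitDensity hm₀ hm₁)
    (fun t ↦ one_half_pos.trans_le (orbitDensity_ge ha₀ ha₁ hm₀ hm₁ t))
    (orbitTime_orbitPhase ha₀ ha₁ hm₀ hm₁) u

theorem orbitTime_neg (t : ℝ) : orbitTime a m (-t) = -orbitTime a m t := by
  have h : ∀ t, orbitDensity a m (-t) = orbitDensity a m t := fun t ↦ by
    simp [orbitDensity, orbitAngle]
  have := intervalIntegral.integral_comp_neg (a := 0) (b := t) (orbitDensity a m)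
  simp only [h, neg_zero] at this
  rw [orbitTime, orbitTime, this, intervalIntegral.integral_symm]

theorem orbitTime_add (hm₀ : 0 < m) (hm₁ : m < 1) {p : ℝ}
    (hp : Function.Periodic (orbitDensity a m) p) (t : ℝ) :
    orbitTime a m (t + p) = orbitTime a m t + orbitTime a m p := by
  have hi := fun x y ↦
    (continuous_orbitDensity (a := a) hm₀ hm₁).intervalIntegrable (μ := MeasureTheory.volume) x y
  have h1 := intervalIntegral.integral_add_adjacent_intervals
    (hi 0 t) (hi t (t + p))
  have h2 := hp.intervalIntegral_add_eq t 0
  rw [zero_add] at h2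
  rw [orbitTime, ← h1, h2]
  rfl

theorem orbitPhase_neg (ha₀ : 0 ≤ a) (ha₁ : a ≤ Real.pi / 6) (hm₀ : 0 < m) (hm₁ : m < 1) (u : ℝ) :
    orbitPhase a m (-u) = -orbitPhase a m u := by
  apply (strictMono_orbitTime ha₀ ha₁ hm₀ hm₁).injective
  rw [orbitTime_neg]
  simp only [orbitTime_orbitPhase ha₀ ha₁ hm₀ hm₁]

theorem orbitPhase_add (ha₀ : 0 ≤ a) (ha₁ : a ≤ Real.pi / 6) (hm₀ : 0 < m) (hm₁ : m < 1) {p : ℝ}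
    (hp : Function.Periodic (orbitDensity a m) p) (u : ℝ) :
    orbitPhase a m (u + orbitTime a m p) = orbitPhase a m u + p := by
  apply (strictMono_orbitTime ha₀ ha₁ hm₀ hm₁).injective
  rw [orbitTime_add hm₀ hm₁ hp]
  simp only [orbitTime_orbitPhase ha₀ ha₁ hm₀ hm₁]

theorem orbitTime_zero : orbitTime a m 0 = 0 := by simp [orbitTime]

theorem orbitTime_int_mul (hm₀ : 0 < m) (hm₁ : m < 1) {p : ℝ}
    (hp : Function.Periodic (orbitDensity a m) p) (n : ℤ) :
    orbitTime a m (n * p) = n * orbitTime a m p := by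
  induction n using Int.induction_on with
  | zero => simp [orbitTime_zero]
  | succ n ih =>
    push_cast at ih ⊢
    rw [add_mul, one_mul, orbitTime_add hm₀ hm₁ hp, ih]
    ring
  | pred n ih =>
    have := orbitTime_add hm₀ hm₁ hp ((-(n : ℤ) - 1 : ℤ) * p)
    rw [show ((-(n : ℤ) - 1 : ℤ) : ℝ) * p + p = (-(n : ℤ) : ℤ) * p by push_cast; ring, ih] at this
    rw [eq_sub_of_add_eq this.symm]
    push_cast
    ring

theorem orbitValue_neg (ha₀ : 0 ≤ a) (ha₁ : a ≤ Real.pi / 6) (hm₀ : 0 < m) (hm₁ : m < 1) (u : ℝ) :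
    orbitValue a m (-u) = orbitValue a m u := by
  simp [orbitValue, orbitAngle, orbitPhase_neg ha₀ ha₁ hm₀ hm₁]

/-- The factor `cos ψ` cancels between the derivative of the angle and the time density. -/
theorem hasDerivAt_orbitAngle_orbitPhase (ha₀ : 0 ≤ a) (ha₁ : a ≤ Real.pi / 6) (hm₀ : 0 < m)
    (hm₁ : m < 1) (u : ℝ) :
    HasDerivAt (fun u ↦ orbitAngle a m (orbitPhase a m u)) (m * Real.sin (orbitPhase a m u) /
      (3 * Real.cos (orbitAngle a m (orbitPhase a m u)))) u := by
  refine ((hasDerivAt_orbitAngle hm₀ hm₁ _).comp u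
    (hasDerivAt_orbitPhase ha₀ ha₁ hm₀ hm₁ u)).congr_deriv ?_
  have h1 := one_half_pos.trans_le (cos_orbitAngle_ge ha₀ ha₁ hm₀ hm₁ (orbitPhase a m u))
  have h2 := cos_arcsin_mul_cos_pos hm₀ hm₁ (orbitPhase a m u)
  rw [orbitDensity]
  field_simp

theorem hasDerivAt_orbitValue (ha₀ : 0 ≤ a) (ha₁ : a ≤ Real.pi / 6) (hm₀ : 0 < m) (hm₁ : m < 1)
    (u : ℝ) : HasDerivAt (orbitValue a m) (orbitVelocity a m u) u := by
  refine ((((hasDerivAt_orbitAngle_orbitPhase ha₀ ha₁ hm₀ hm₁ u).cos.pow 2).const_mul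
    4).sub_const 3).congr_deriv ?_
  have h1 := one_half_pos.trans_le (cos_orbitAngle_ge ha₀ ha₁ hm₀ hm₁ (orbitPhase a m u))
  rw [orbitVelocity]
  field_simp
  norm_num
  ring

theorem hasDerivAt_orbitVelocity (ha₀ : 0 ≤ a) (ha₁ : a ≤ Real.pi / 6) (hm₀ : 0 < m) (hm₁ : m < 1)
    (u : ℝ) : HasDerivAt (orbitVelocity a m) (-(8 / 9) * (m * Real.sin (orbitPhase a m u)) ^ 2 -
      8 / 3 * Real.sin (orbitAngle a m (orbitPhase a m u)) *
        (m * Real.cos (orbitPhase a m u)) *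
        Real.cos (Real.arcsin (m * Real.cos (orbitPhase a m u))) /
        Real.cos (orbitAngle a m (orbitPhase a m u))) u := by
  refine (((hasDerivAt_orbitAngle_orbitPhase ha₀ ha₁ hm₀ hm₁ u).sin.mul
    (hasDerivAt_orbitPhase ha₀ ha₁ hm₀ hm₁ u).sin).const_mul (-(8 / 3) * m)).congr_deriv ?_
  have h1 := one_half_pos.trans_le (cos_orbitAngle_ge ha₀ ha₁ hm₀ hm₁ (orbitPhase a m u))
  have h2 := cos_arcsin_mul_cos_pos hm₀ hm₁ (orbitPhase a m u)
  rw [orbitDensity]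
  field_simp
  ring

end Orbit

/-! ### Hypergeometric values of the periods, and identification of `δ_κ`. -/

section RealPeriod

variable {m : ℝ}

theorem orbitDensity_zero_eq (hm₀ : 0 < m) (hm₁ : m < 1) (t : ℝ) :
    orbitDensity 0 m t =
      ₂F₁ (1 / 3 : ℝ) (2 / 3 : ℝ) (1 / 2 : ℝ) (m ^ 2 * Real.cos t ^ 2) := by
  have h := abs_mul_cos_lt_one hm₀ hm₁ t
  have := hypergeometric_one_third_sin_sq (arcsin_mem_Ioo h)
  rw [Real.sin_arcsin h.1.le h.2.le, mul_pow] at this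
  rw [this, orbitDensity, orbitAngle, zero_sub, Real.cos_neg]

theorem hypergeometric_sin_sq_eq (hm₀ : 0 < m) (hm₁ : m < 1) (t : ℝ) :
    ₂F₁ (1 / 3 : ℝ) (2 / 3 : ℝ) (1 / 2 : ℝ) (m ^ 2 * Real.sin t ^ 2) =
      orbitDensity 0 m (t - Real.pi / 2) := by
  rw [orbitDensity_zero_eq hm₀ hm₁, Real.cos_sub_pi_div_two]

theorem periodic_orbitDensity_zero : Function.Periodic (orbitDensity 0 m) Real.pi := fun t ↦ by
  simp [orbitDensity, orbitAngle, Real.arcsin_neg, neg_div]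

theorem periodic_orbitDensity_two_pi (a : ℝ) :
    Function.Periodic (orbitDensity a m) (2 * Real.pi) := fun t ↦ by
  simp [orbitDensity, orbitAngle]

theorem orbitTime_zero_pi (hm₀ : 0 < m) (hm₁ : m < 1) :
    orbitTime 0 m Real.pi = Real.pi * ₂F₁ (1 / 3 : ℝ) (2 / 3 : ℝ) (1 : ℝ) (m ^ 2) := by
  rw [← integral_ordinaryHypergeometric_sin_sq (by norm_num) (by norm_num) hm₀.le hm₁]
  simp_rw [hypergeometric_sin_sq_eq hm₀ hm₁]
  rw [intervalIntegral.integral_comp_sub_right (orbitDensity 0 m), orbitTime]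
  have := (periodic_orbitDensity_zero (m := m)).intervalIntegral_add_eq 0 (0 - Real.pi / 2)
  rw [zero_add] at this
  rw [this]
  congr 1
  ring

theorem integral_eq_zero_of_antiperiodic {g : ℝ → ℝ} (hg : Continuous g) {c : ℝ}
    (h : Function.Antiperiodic g c) : ∫ t in (0 : ℝ)..2 * c, g t = 0 := by
  have h1 := intervalIntegral.integral_add_adjacent_intervals
    (hg.intervalIntegrable (μ := MeasureTheory.volume) 0 c)
    (hg.intervalIntegrable (μ := MeasureTheory.volume) c (2 * c))
  have h2 := intervalIntegral.integral_comp_add_right (a := 0) (b := c) g c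
  have h3 : ∫ t in (0 : ℝ)..c, g (t + c) = -∫ t in (0 : ℝ)..c, g t := by
    rw [← intervalIntegral.integral_neg]
    exact intervalIntegral.integral_congr fun t _ ↦ h t
  rw [zero_add, ← two_mul] at h2
  rw [← h1, ← h2, h3, add_neg_cancel]

/-- Expand `cos(π/6 - ψ/3)`: the cosine part is `√3/2` times the density for `a = 0`, while the sine
part changes sign under `t ↦ t + π` and integrates to zero over a full turn. -/
theorem orbitTime_pi_div_six_two_pi (hm₀ : 0 < m) (hm₁ : m < 1) :
    orbitTime (Real.pi / 6) m (2 * Real.pi) =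
      √3 * Real.pi * ₂F₁ (1 / 3 : ℝ) (2 / 3 : ℝ) (1 : ℝ) (m ^ 2) := by
  set g : ℝ → ℝ := fun t ↦ Real.sin (Real.arcsin (m * Real.cos t) / 3) /
    Real.cos (Real.arcsin (m * Real.cos t)) with hg
  have hgc : Continuous g :=
    Continuous.div (by fun_prop) (by fun_prop) fun t ↦ (cos_arcsin_mul_cos_pos hm₀ hm₁ t).ne'
  have hga : Function.Antiperiodic g Real.pi := fun t ↦ by
    simp [hg, Real.arcsin_neg, neg_div]
  have hd : orbitDensity (Real.pi / 6) m =
      fun t ↦ √3 / 2 * orbitDensity 0 m t + 1 / 2 * g t := by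
    ext t
    rw [hg, orbitDensity, orbitDensity, orbitAngle, orbitAngle, Real.cos_sub, zero_sub,
      Real.cos_neg, Real.cos_pi_div_six, Real.sin_pi_div_six]
    ring
  have h0 : orbitTime 0 m (2 * Real.pi) = 2 * orbitTime 0 m Real.pi := by
    rw [two_mul, orbitTime_add hm₀ hm₁ periodic_orbitDensity_zero]
    ring
  have hc := continuous_orbitDensity (a := 0) hm₀ hm₁
  rw [orbitTime, hd, intervalIntegral.integral_add
    ((hc.const_mul _).intervalIntegrable _ _) ((hgc.const_mul _).intervalIntegrable _ _),
    intervalIntegral.integral_const_mul, intervalIntegral.integral_const_mul,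
    integral_eq_zero_of_antiperiodic hgc hga]
  change √3 / 2 * orbitTime 0 m (2 * Real.pi) + _ = _
  rw [h0, orbitTime_zero_pi hm₀ hm₁]
  ring

/-- The integrand has `sin` where the orbit has `cos`. The quarter-turn shift of phase becomes the
time shift by half of `orbitTime 0 m π` in `shenPhi_eq`. -/
theorem shenIntegral_eq (hm₀ : 0 < m) (hm₁ : m < 1) (T : ℝ) :
    shenIntegral m T = orbitTime 0 m (T - Real.pi / 2) + orbitTime 0 m (Real.pi / 2) := by
  have hi := (continuous_orbitDensity (a := 0) hm₀ hm₁).intervalIntegrable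
    (μ := MeasureTheory.volume)
  have h1 := intervalIntegral.integral_add_adjacent_intervals
    (hi (-(Real.pi / 2)) 0) (hi 0 (T - Real.pi / 2))
  have h2 : ∫ t in (-(Real.pi / 2))..0, orbitDensity 0 m t = orbitTime 0 m (Real.pi / 2) := by
    rw [intervalIntegral.integral_symm]
    change -orbitTime 0 m (-(Real.pi / 2)) = _
    rw [orbitTime_neg, neg_neg]
  rw [shenIntegral]
  simp_rw [hypergeometric_sin_sq_eq hm₀ hm₁]
  rw [intervalIntegral.integral_comp_sub_right (orbitDensity 0 m), zero_sub, ← h1, h2, add_comm]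
  rfl

theorem orbitTime_zero_pi_div_two (hm₀ : 0 < m) (hm₁ : m < 1) :
    orbitTime 0 m (Real.pi / 2) = orbitTime 0 m Real.pi / 2 := by
  have := orbitTime_add hm₀ hm₁ (periodic_orbitDensity_zero (m := m)) (-(Real.pi / 2))
  rw [orbitTime_neg, show -(Real.pi / 2) + Real.pi = Real.pi / 2 by ring] at this
  linarith

theorem zero_le_pi_div_six : 0 ≤ Real.pi / 6 := by positivity

theorem strictMono_shenIntegral (hm₀ : 0 < m) (hm₁ : m < 1) : StrictMono (shenIntegral m) :=
  fun x y hxy ↦ by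
    rw [shenIntegral_eq hm₀ hm₁, shenIntegral_eq hm₀ hm₁]
    have := strictMono_orbitTime le_rfl zero_le_pi_div_six hm₀ hm₁
      (show x - Real.pi / 2 < y - Real.pi / 2 by linarith)
    linarith

theorem shenIntegral_orbitPhase (hm₀ : 0 < m) (hm₁ : m < 1) (u : ℝ) :
    shenIntegral m (orbitPhase 0 m (u - orbitTime 0 m Real.pi / 2) + Real.pi / 2) = u := by
  rw [shenIntegral_eq hm₀ hm₁, add_sub_cancel_right,
    orbitTime_orbitPhase le_rfl zero_le_pi_div_six hm₀ hm₁, orbitTime_zero_pi_div_two hm₀ hm₁,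
    sub_add_cancel]

theorem surjective_shenIntegral (hm₀ : 0 < m) (hm₁ : m < 1) :
    Function.Surjective (shenIntegral m) :=
  fun u ↦ ⟨_, shenIntegral_orbitPhase hm₀ hm₁ u⟩

theorem shenPhi_eq (hm₀ : 0 < m) (hm₁ : m < 1) (u : ℝ) :
    shenPhi m u = orbitPhase 0 m (u - orbitTime 0 m Real.pi / 2) + Real.pi / 2 := by
  apply (strictMono_shenIntegral hm₀ hm₁).injective
  rw [shenIntegral_orbitPhase hm₀ hm₁]
  exact Function.rightInverse_invFun (surjective_shenIntegral hm₀ hm₁) u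

/-- The density is `cos φ / cos 3φ`, so this is the triple-angle formula. It makes the speed of the
phase equal to the position of the orbit. -/
theorem inv_orbitDensity_zero (hm₀ : 0 < m) (hm₁ : m < 1) (t : ℝ) :
    (orbitDensity 0 m t)⁻¹ = 4 * Real.cos (orbitAngle 0 m t) ^ 2 - 3 := by
  have h1 := one_half_pos.trans_le (cos_orbitAngle_ge le_rfl zero_le_pi_div_six hm₀ hm₁ t)
  have h3 : Real.cos (Real.arcsin (m * Real.cos t)) = Real.cos (3 * orbitAngle 0 m t) := by
    rw [orbitAngle, ← Real.cos_neg]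
    congr 1
    ring
  rw [orbitDensity, inv_div, h3, Real.cos_three_mul]
  field_simp

theorem hasDerivAt_shenPhi (hm₀ : 0 < m) (hm₁ : m < 1) (u : ℝ) :
    HasDerivAt (shenPhi m) (orbitValue 0 m (u - orbitTime 0 m Real.pi / 2)) u := by
  rw [show shenPhi m = fun u ↦ orbitPhase 0 m (u - orbitTime 0 m Real.pi / 2) + Real.pi / 2 from
    funext (shenPhi_eq hm₀ hm₁)]
  refine (((hasDerivAt_orbitPhase le_rfl zero_le_pi_div_six hm₀ hm₁ _).comp u
    ((hasDerivAt_id u).sub_const _)).add_const _).congr_deriv ?_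
  rw [inv_orbitDensity_zero hm₀ hm₁, mul_one]
  rfl

theorem shenDelta_eq (hm₀ : 0 < m) (hm₁ : m < 1) (u : ℝ) :
    shenDelta m u = orbitValue 0 m (u - orbitTime 0 m Real.pi / 2) :=
  (hasDerivAt_shenPhi hm₀ hm₁ u).deriv

end RealPeriod

/-! ### The two real motions and their common quartic. -/

/-- The quartic governing the motion `x' ^ 2 = f x`. -/
noncomputable def orbitQuartic (e x : ℝ) : ℝ :=
  4 / 9 * (1 - x) * (x ^ 3 + 3 * x ^ 2 - e ^ 3 - 3 * e ^ 2)

/-- Half the derivative of `orbitQuartic`. -/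
noncomputable def orbitForce (e x : ℝ) : ℝ :=
  2 / 9 * (-(x ^ 3 + 3 * x ^ 2 - e ^ 3 - 3 * e ^ 2) + (1 - x) * (3 * x ^ 2 + 6 * x))

/-- A pair of real periodic motions `X`, `Y` on adjacent ovals of `orbitQuartic e`, meeting
only at the common turning point `e`. -/
structure IsOrbitPair (e p q : ℝ) (X X' Y Y' : ℝ → ℝ) : Prop where
  e_pos : 0 < e
  e_lt_one : e < 1
  p_pos : 0 < p
  q_pos : 0 < q
  hasDerivAt_X : ∀ u, HasDerivAt X (X' u) u
  hasDerivAt_X' : ∀ u, HasDerivAt X' (orbitForce e (X u)) u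
  sq_X' : ∀ u, X' u ^ 2 = orbitQuartic e (X u)
  hasDerivAt_Y : ∀ v, HasDerivAt Y (Y' v) v
  hasDerivAt_Y' : ∀ v, HasDerivAt Y' (-orbitForce e (Y v)) v
  sq_Y' : ∀ v, Y' v ^ 2 = -orbitQuartic e (Y v)
  X_neg : ∀ u, X (-u) = X u
  Y_neg : ∀ v, Y (-v) = Y v
  X_add : Function.Periodic X p
  Y_add : Function.Periodic Y q
  le_X : ∀ u, e ≤ X u
  X_le : ∀ u, X u ≤ 1
  Y_le : ∀ v, Y v ≤ e
  X_zero : X 0 = e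
  Y_zero : Y 0 = e
  X_eq : ∀ u, X u = e → ∃ n : ℤ, u = n * p
  Y_eq : ∀ v, Y v = e → ∃ n : ℤ, v = n * q
  X_half : X (p / 2) = 1
  Y_values : ∃ v₁ v₂ v₃, Y v₁ < Y v₂ ∧ Y v₂ < Y v₃

theorem cos_lt_cos_abs {x y : ℝ} (h : |x| < |y|) (hy : |y| ≤ Real.pi) :
    Real.cos y < Real.cos x := by
  rw [← Real.cos_abs x, ← Real.cos_abs y]
  exact Real.cos_lt_cos_of_nonneg_of_le_pi (abs_nonneg x) hy h

section Ovals

variable {m : ℝ}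

theorem angle_zero_relations (hm₀ : 0 < m) (hm₁ : m < 1) (t : ℝ) :
    m * Real.cos t = -Real.sin (3 * orbitAngle 0 m t) ∧
      Real.cos (Real.arcsin (m * Real.cos t)) = Real.cos (3 * orbitAngle 0 m t) := by
  have h := abs_mul_cos_lt_one hm₀ hm₁ t
  have h3 : 3 * orbitAngle 0 m t = -Real.arcsin (m * Real.cos t) := by rw [orbitAngle]; ring
  rw [h3, Real.sin_neg, Real.cos_neg, Real.sin_arcsin h.1.le h.2.le, neg_neg]
  exact ⟨rfl, rfl⟩

theorem angle_pi_div_six_relations (hm₀ : 0 < m) (hm₁ : m < 1) (t : ℝ) :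
    m * Real.cos t = Real.cos (3 * orbitAngle (Real.pi / 6) m t) ∧
      Real.cos (Real.arcsin (m * Real.cos t)) =
        Real.sin (3 * orbitAngle (Real.pi / 6) m t) := by
  have h := abs_mul_cos_lt_one hm₀ hm₁ t
  have h3 : 3 * orbitAngle (Real.pi / 6) m t = Real.pi / 2 - Real.arcsin (m * Real.cos t) := by
    rw [orbitAngle]; ring
  rw [h3, Real.sin_pi_div_two_sub, Real.cos_pi_div_two_sub, Real.sin_arcsin h.1.le h.2.le]
  exact ⟨rfl, rfl⟩

/-- Here `(m sin t)² = m² - sin² 3φ`, and with `x = 4cos²φ - 3` one has `4cos² 3φ = x³ + 3x²` and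
`4sin²φ = 1 - x`. The relation `he` turns the remaining constant into `e³ + 3e²`. -/
theorem sq_orbitVelocity_zero (hm₀ : 0 < m) (hm₁ : m < 1) {e : ℝ}
    (he : 4 * m ^ 2 = (1 - e) * (e + 2) ^ 2) (u : ℝ) :
    orbitVelocity 0 m u ^ 2 = orbitQuartic e (orbitValue 0 m u) := by
  obtain ⟨h2, -⟩ := angle_zero_relations hm₀ hm₁ (orbitPhase 0 m u)
  have h4 := Real.sin_sq_add_cos_sq (orbitPhase 0 m u)
  have h5 := Real.sin_sq (orbitAngle 0 m (orbitPhase 0 m u))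
  rw [Real.sin_three_mul] at h2
  rw [orbitVelocity, orbitValue, orbitQuartic]
  generalize Real.sin (orbitAngle 0 m (orbitPhase 0 m u)) = s at *
  generalize Real.cos (orbitAngle 0 m (orbitPhase 0 m u)) = c at *
  generalize Real.sin (orbitPhase 0 m u) = S at *
  generalize Real.cos (orbitPhase 0 m u) = C at *
  have h6 : (m * S) ^ 2 = m ^ 2 - s ^ 2 * (3 - 4 * s ^ 2) ^ 2 := by
    rw [mul_pow, eq_sub_of_add_eq h4, mul_sub, ← mul_pow, h2]
    ring
  have h7 : (-(8 / 3) * m * (s * S)) ^ 2 = 64 / 9 * s ^ 2 * (m * S) ^ 2 := by ring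
  rw [h7, h6, h5]
  linear_combination 16 / 9 * (1 - c ^ 2) * he

theorem hasDerivAt_orbitVelocity_zero (hm₀ : 0 < m) (hm₁ : m < 1) {e : ℝ}
    (he : 4 * m ^ 2 = (1 - e) * (e + 2) ^ 2) (u : ℝ) :
    HasDerivAt (orbitVelocity 0 m) (orbitForce e (orbitValue 0 m u)) u := by
  refine (hasDerivAt_orbitVelocity le_rfl zero_le_pi_div_six hm₀ hm₁ u).congr_deriv ?_
  have h1 := one_half_pos.trans_le
    (cos_orbitAngle_ge le_rfl zero_le_pi_div_six hm₀ hm₁ (orbitPhase 0 m u))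
  obtain ⟨h2, h3⟩ := angle_zero_relations hm₀ hm₁ (orbitPhase 0 m u)
  have h4 := Real.sin_sq_add_cos_sq (orbitPhase 0 m u)
  have h5 := Real.sin_sq (orbitAngle 0 m (orbitPhase 0 m u))
  rw [Real.sin_three_mul] at h2
  rw [Real.cos_three_mul] at h3
  rw [h3, orbitValue, orbitForce]
  generalize Real.sin (orbitAngle 0 m (orbitPhase 0 m u)) = s at *
  generalize Real.cos (orbitAngle 0 m (orbitPhase 0 m u)) = c at *
  generalize Real.sin (orbitPhase 0 m u) = S at *
  generalize Real.cos (orbitPhase 0 m u) = C at *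
  have h6 : (m * S) ^ 2 = m ^ 2 - s ^ 2 * (3 - 4 * s ^ 2) ^ 2 := by
    rw [mul_pow, eq_sub_of_add_eq h4, mul_sub, ← mul_pow, h2]
    ring
  have h7 : 8 / 3 * s * (m * C) * (4 * c ^ 3 - 3 * c) / c =
      -(8 / 3) * s ^ 2 * (3 - 4 * s ^ 2) * (4 * c ^ 2 - 3) := by
    rw [h2]
    field_simp
  rw [h7, h6, h5]
  linear_combination -(2 / 9) * he

/-- The offset `π/6` turns `sin 3φ` into `cos 3φ`, so `4(m sin t)² = 4m² - (x³ + 3x²)`: the cubic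
factor reappears with the opposite sign. -/
theorem sq_orbitVelocity_pi_div_six (hm₀ : 0 < m) (hm₁ : m < 1) {e : ℝ}
    (he : 4 * m ^ 2 = e ^ 2 * (e + 3)) (u : ℝ) :
    orbitVelocity (Real.pi / 6) m u ^ 2 = -orbitQuartic e (orbitValue (Real.pi / 6) m u) := by
  obtain ⟨h2, -⟩ := angle_pi_div_six_relations hm₀ hm₁ (orbitPhase (Real.pi / 6) m u)
  have h4 := Real.sin_sq_add_cos_sq (orbitPhase (Real.pi / 6) m u)
  have h5 := Real.sin_sq (orbitAngle (Real.pi / 6) m (orbitPhase (Real.pi / 6) m u))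
  rw [Real.cos_three_mul] at h2
  rw [orbitVelocity, orbitValue, orbitQuartic]
  generalize Real.sin (orbitAngle (Real.pi / 6) m (orbitPhase (Real.pi / 6) m u)) = s at *
  generalize Real.cos (orbitAngle (Real.pi / 6) m (orbitPhase (Real.pi / 6) m u)) = c at *
  generalize Real.sin (orbitPhase (Real.pi / 6) m u) = S at *
  generalize Real.cos (orbitPhase (Real.pi / 6) m u) = C at *
  have h6 : (m * S) ^ 2 = m ^ 2 - c ^ 2 * (4 * c ^ 2 - 3) ^ 2 := by
    rw [mul_pow, eq_sub_of_add_eq h4, mul_sub, ← mul_pow, h2]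
    ring
  have h7 : (-(8 / 3) * m * (s * S)) ^ 2 = 64 / 9 * s ^ 2 * (m * S) ^ 2 := by ring
  rw [h7, h6, h5]
  linear_combination 16 / 9 * (1 - c ^ 2) * he

theorem hasDerivAt_orbitVelocity_pi_div_six (hm₀ : 0 < m) (hm₁ : m < 1) {e : ℝ}
    (he : 4 * m ^ 2 = e ^ 2 * (e + 3)) (u : ℝ) :
    HasDerivAt (orbitVelocity (Real.pi / 6) m)
      (-orbitForce e (orbitValue (Real.pi / 6) m u)) u := by
  refine (hasDerivAt_orbitVelocity zero_le_pi_div_six le_rfl hm₀ hm₁ u).congr_deriv ?_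
  have h1 := one_half_pos.trans_le
    (cos_orbitAngle_ge zero_le_pi_div_six le_rfl hm₀ hm₁ (orbitPhase (Real.pi / 6) m u))
  obtain ⟨h2, h3⟩ := angle_pi_div_six_relations hm₀ hm₁ (orbitPhase (Real.pi / 6) m u)
  have h4 := Real.sin_sq_add_cos_sq (orbitPhase (Real.pi / 6) m u)
  have h5 := Real.sin_sq (orbitAngle (Real.pi / 6) m (orbitPhase (Real.pi / 6) m u))
  rw [Real.cos_three_mul] at h2
  rw [Real.sin_three_mul] at h3
  rw [h3, orbitValue, orbitForce]
  generalize Real.sin (orbitAngle (Real.pi / 6) m (orbitPhase (Real.pi / 6) m u)) = s at *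
  generalize Real.cos (orbitAngle (Real.pi / 6) m (orbitPhase (Real.pi / 6) m u)) = c at *
  generalize Real.sin (orbitPhase (Real.pi / 6) m u) = S at *
  generalize Real.cos (orbitPhase (Real.pi / 6) m u) = C at *
  have h6 : (m * S) ^ 2 = m ^ 2 - c ^ 2 * (4 * c ^ 2 - 3) ^ 2 := by
    rw [mul_pow, eq_sub_of_add_eq h4, mul_sub, ← mul_pow, h2]
    ring
  have h7 : 8 / 3 * s * (m * C) * (3 * s - 4 * s ^ 3) / c =
      8 / 3 * s ^ 2 * (3 - 4 * s ^ 2) * (4 * c ^ 2 - 3) := by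
    rw [h2]
    field_simp
  rw [h7, h6, h5]
  linear_combination -(2 / 9) * he

variable {θ : ℝ}

theorem lt_value_of_abs_cos_lt (hm₀ : 0 < m) (hm₁ : m < 1) (hθ : Real.arcsin m = 3 * θ)
    (hθ₀ : 0 < θ) (hθ₁ : θ < Real.pi / 6) {t : ℝ} (ht : |Real.cos t| < 1) :
    4 * Real.cos θ ^ 2 - 3 < 4 * Real.cos (orbitAngle 0 m t) ^ 2 - 3 := by
  have hb := abs_mul_cos_lt_one hm₀ hm₁ t
  have h1 : |Real.arcsin (m * Real.cos t)| < 3 * θ := by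
    rw [abs_lt] at ht
    rw [← hθ, abs_lt, ← Real.arcsin_neg]
    exact ⟨Real.strictMonoOn_arcsin ⟨by linarith, by linarith⟩ ⟨hb.1.le, hb.2.le⟩ (by nlinarith),
      Real.strictMonoOn_arcsin ⟨hb.1.le, hb.2.le⟩ ⟨by linarith, by linarith⟩ (by nlinarith)⟩
  have h2 : Real.cos θ < Real.cos (orbitAngle 0 m t) := by
    refine cos_lt_cos_abs ?_ (by rw [abs_of_pos hθ₀]; linarith [Real.pi_pos])
    rw [orbitAngle, zero_sub, abs_neg, abs_div, abs_of_pos hθ₀, abs_of_pos (three_pos (α := ℝ))]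
    linarith
  have h3 : 0 < Real.cos θ :=
    Real.cos_pos_of_mem_Ioo ⟨by linarith [Real.pi_pos], by linarith [Real.pi_pos]⟩
  nlinarith

theorem le_value (hm₀ : 0 < m) (hm₁ : m < 1) (hθ : Real.arcsin m = 3 * θ)
    (hθ₀ : 0 < θ) (hθ₁ : θ < Real.pi / 6) (t : ℝ) :
    4 * Real.cos θ ^ 2 - 3 ≤ 4 * Real.cos (orbitAngle 0 m t) ^ 2 - 3 := by
  rcases (Real.abs_cos_le_one t).lt_or_eq with h | h
  · exact (lt_value_of_abs_cos_lt hm₀ hm₁ hθ hθ₀ hθ₁ h).le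
  · rw [orbitAngle]
    rcases eq_or_eq_neg_of_abs_eq h with h | h <;> simp [h, Real.arcsin_neg, neg_div, hθ]

/-- The angle decreases as `cos t` grows and stays in `[0, π/3)`, where cosine is decreasing. Thus
this motion turns at its top only for `cos t = 1`, once per `2π`, whereas for `a = 0` both signs of
`cos t` give the lower turning point. -/
theorem value_lt_of_cos_lt (hm₀ : 0 < m) (hm₁ : m < 1) {s t : ℝ} (h : Real.cos s < Real.cos t) :
    4 * Real.cos (orbitAngle (Real.pi / 6) m s) ^ 2 - 3 <
      4 * Real.cos (orbitAngle (Real.pi / 6) m t) ^ 2 - 3 := by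
  have hs := abs_mul_cos_lt_one hm₀ hm₁ s
  have ht := abs_mul_cos_lt_one hm₀ hm₁ t
  have h1 : Real.arcsin (m * Real.cos s) < Real.arcsin (m * Real.cos t) :=
    Real.strictMonoOn_arcsin ⟨hs.1.le, hs.2.le⟩ ⟨ht.1.le, ht.2.le⟩ (by nlinarith)
  have h3 := (orbitAngle_mem zero_le_pi_div_six le_rfl hm₀ hm₁ s).2
  have h4 := Real.arcsin_le_pi_div_two (m * Real.cos t)
  have h2 : Real.cos (orbitAngle (Real.pi / 6) m s) <
      Real.cos (orbitAngle (Real.pi / 6) m t) := by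
    refine Real.cos_lt_cos_of_nonneg_of_le_pi ?_ (by linarith [Real.pi_pos]) ?_
    · rw [orbitAngle]
      linarith
    · rw [orbitAngle, orbitAngle]
      linarith
  have := cos_orbitAngle_ge zero_le_pi_div_six le_rfl hm₀ hm₁ s
  nlinarith

theorem value_eq_of_cos_eq_one (hθ : Real.arcsin m = Real.pi / 2 - 3 * θ) {t : ℝ}
    (ht : Real.cos t = 1) :
    4 * Real.cos (orbitAngle (Real.pi / 6) m t) ^ 2 - 3 = 4 * Real.cos θ ^ 2 - 3 := by
  rw [orbitAngle, ht, mul_one, hθ]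
  congr 4
  ring

end Ovals

theorem isOrbitPair {κ : ℝ} (hκ₀ : 0 < κ) (hκ₁ : κ < 1) :
    ∃ e, 4 * κ ^ 2 = (1 - e) * (e + 2) ^ 2 ∧
      IsOrbitPair e (orbitTime 0 κ Real.pi) (orbitTime (Real.pi / 6) √(1 - κ ^ 2) (2 * Real.pi))
        (orbitValue 0 κ) (orbitVelocity 0 κ) (orbitValue (Real.pi / 6) √(1 - κ ^ 2))
        (orbitVelocity (Real.pi / 6) √(1 - κ ^ 2)) := by
  have hpi := Real.pi_pos
  have h6 := zero_le_pi_div_six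
  have hk2 : 0 < 1 - κ ^ 2 := by nlinarith
  obtain ⟨l, hl⟩ : ∃ l, l = √(1 - κ ^ 2) := ⟨_, rfl⟩
  rw [← hl]
  have hl2 : l ^ 2 = 1 - κ ^ 2 := by rw [hl, Real.sq_sqrt hk2.le]
  have hl₀ : 0 < l := hl ▸ Real.sqrt_pos.2 hk2
  have hl₁ : l < 1 := by
    rw [hl, Real.sqrt_lt' one_pos]
    nlinarith
  obtain ⟨θ, hθ⟩ : ∃ θ, Real.arcsin κ = 3 * θ := ⟨Real.arcsin κ / 3, by ring⟩
  have hκs : κ = Real.sin (3 * θ) := by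
    rw [← hθ, Real.sin_arcsin (by linarith) hκ₁.le]
  have hθ0 : 0 < θ := by
    have := Real.arcsin_pos.2 hκ₀
    linarith
  have hθ1 : θ < Real.pi / 6 := by
    have := Real.arcsin_lt_pi_div_two.2 hκ₁
    linarith
  -- As `κ = sin 3θ`, the complementary modulus is `cos 3θ`. At `cos t = 1` the second angle is
  -- therefore `θ`, so both motions share the turning point `4cos²θ - 3`.
  have hlθ : Real.arcsin l = Real.pi / 2 - 3 * θ := by
    rw [← hθ, ← Real.arccos_eq_pi_div_two_sub_arcsin, Real.arccos_eq_arcsin hκ₀.le, hl]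
  obtain ⟨e, he⟩ : ∃ e, e = 4 * Real.cos θ ^ 2 - 3 := ⟨_, rfl⟩
  have hκe : 4 * κ ^ 2 = (1 - e) * (e + 2) ^ 2 := by
    have h1 : κ ^ 2 = Real.sin θ ^ 2 * (3 - 4 * Real.sin θ ^ 2) ^ 2 := by
      rw [hκs, Real.sin_three_mul]; ring
    rw [h1, Real.sin_sq, he]
    ring
  have hle : 4 * l ^ 2 = e ^ 2 * (e + 3) := by linear_combination 4 * hl2 - hκe
  have he0 : 0 < e := by
    have h1 : Real.cos (Real.pi / 6) < Real.cos θ :=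
      Real.cos_lt_cos_of_nonneg_of_le_pi hθ0.le (by linarith) hθ1
    rw [Real.cos_pi_div_six] at h1
    have := Real.sq_sqrt (show (0 : ℝ) ≤ 3 by norm_num)
    have := Real.sqrt_nonneg 3
    nlinarith
  have he1 : e < 1 := by
    have := Real.sin_pos_of_pos_of_lt_pi hθ0 (by linarith)
    nlinarith [Real.sin_sq_add_cos_sq θ]
  have hX_lt : ∀ t, |Real.cos t| < 1 → e < 4 * Real.cos (orbitAngle 0 κ t) ^ 2 - 3 := fun t ht ↦
    he ▸ lt_value_of_abs_cos_lt hκ₀ hκ₁ hθ hθ0 hθ1 ht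
  have hY_of : ∀ t, Real.cos t = 1 → 4 * Real.cos (orbitAngle (Real.pi / 6) l t) ^ 2 - 3 = e :=
    fun t ht ↦ he ▸ value_eq_of_cos_eq_one hlθ ht
  have hY_lt : ∀ t, Real.cos t < 1 → 4 * Real.cos (orbitAngle (Real.pi / 6) l t) ^ 2 - 3 < e :=
    fun t ht ↦ by
    rw [← hY_of 0 Real.cos_zero]
    exact value_lt_of_cos_lt hl₀ hl₁ (by rwa [Real.cos_zero])
  have hPX := orbitPhase_orbitTime le_rfl h6 hκ₀ hκ₁
  have hPY := orbitPhase_orbitTime h6 le_rfl hl₀ hl₁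
  have hTX := orbitTime_orbitPhase le_rfl h6 hκ₀ hκ₁
  have hTY := orbitTime_orbitPhase h6 le_rfl hl₀ hl₁
  have hX0 : orbitPhase 0 κ 0 = 0 := by simpa [orbitTime_zero] using hPX 0
  have hY0 : orbitPhase (Real.pi / 6) l 0 = 0 := by simpa [orbitTime_zero] using hPY 0
  refine ⟨e, hκe, he0, he1, ?_, ?_, hasDerivAt_orbitValue le_rfl h6 hκ₀ hκ₁,
    hasDerivAt_orbitVelocity_zero hκ₀ hκ₁ hκe, sq_orbitVelocity_zero hκ₀ hκ₁ hκe,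
    hasDerivAt_orbitValue h6 le_rfl hl₀ hl₁, hasDerivAt_orbitVelocity_pi_div_six hl₀ hl₁ hle,
    sq_orbitVelocity_pi_div_six hl₀ hl₁ hle,
    orbitValue_neg le_rfl h6 hκ₀ hκ₁, orbitValue_neg h6 le_rfl hl₀ hl₁, fun u ↦ ?_, fun v ↦ ?_,
    fun u ↦ he ▸ le_value hκ₀ hκ₁ hθ hθ0 hθ1 _, fun u ↦ ?_, fun v ↦ ?_, ?_, ?_, fun u hu ↦ ?_,
    fun v hv ↦ ?_, ?_, ?_⟩
  · simpa [orbitTime_zero] using strictMono_orbitTime le_rfl h6 hκ₀ hκ₁ hpi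
  · simpa [orbitTime_zero] using
      strictMono_orbitTime h6 le_rfl hl₀ hl₁ (show (0 : ℝ) < 2 * Real.pi by positivity)
  · simp [orbitValue, orbitPhase_add le_rfl h6 hκ₀ hκ₁ periodic_orbitDensity_zero, orbitAngle,
      Real.arcsin_neg, neg_div]
  · simp [orbitValue, orbitPhase_add h6 le_rfl hl₀ hl₁ (periodic_orbitDensity_two_pi _), orbitAngle]
  · have := Real.cos_sq_le_one (orbitAngle 0 κ (orbitPhase 0 κ u))
    rw [orbitValue]; linarith
  · rcases (Real.cos_le_one (orbitPhase (Real.pi / 6) l v)).lt_or_eq with h | h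
    · exact (hY_lt _ h).le
    · exact (hY_of _ h).le
  · simp [orbitValue, hX0, orbitAngle, he, hθ]
  · rw [orbitValue, hY0, hY_of _ Real.cos_zero]
  · have h1 : Real.sin (orbitPhase 0 κ u) = 0 := by
      by_contra h
      have := Real.sin_sq_add_cos_sq (orbitPhase 0 κ u)
      have h2 : |Real.cos (orbitPhase 0 κ u)| < 1 := by
        rw [← sq_lt_one_iff_abs_lt_one]
        have := sq_pos_of_ne_zero h
        linarith
      exact (hX_lt _ h2).ne' hu
    obtain ⟨n, hn⟩ := Real.sin_eq_zero_iff.1 h1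
    refine ⟨n, ?_⟩
    rw [← orbitTime_int_mul hκ₀ hκ₁ periodic_orbitDensity_zero, hn, hTX]
  · have h1 : Real.cos (orbitPhase (Real.pi / 6) l v) = 1 := by
      by_contra h
      exact (hY_lt _ ((Real.cos_le_one _).lt_of_ne h)).ne hv
    obtain ⟨n, hn⟩ := (Real.cos_eq_one_iff _).1 h1
    refine ⟨n, ?_⟩
    rw [← orbitTime_int_mul hl₀ hl₁ (periodic_orbitDensity_two_pi _), hn, hTY]
  · rw [← orbitTime_zero_pi_div_two hκ₀ hκ₁, orbitValue, hPX]
    simp [orbitAngle]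
    norm_num
  · have hmono : ∀ s t, Real.cos s < Real.cos t →
        orbitValue (Real.pi / 6) l (orbitTime (Real.pi / 6) l s) <
          orbitValue (Real.pi / 6) l (orbitTime (Real.pi / 6) l t) := fun s t hst ↦ by
      rw [orbitValue, orbitValue, hPY, hPY]
      exact value_lt_of_cos_lt hl₀ hl₁ hst
    exact ⟨_, _, _, hmono Real.pi (Real.pi / 2) (by simp), hmono (Real.pi / 2) 0 (by simp)⟩

/-! ### Characterizations of the Weierstrass function. -/

section

open Filter Topology
open scoped PeriodPair Pointwise

theorem PeriodPair.tendsto_sq_mul_weierstrassP (L : PeriodPair) :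
    Tendsto (fun z ↦ z ^ 2 * ℘[L] z) (𝓝[≠] 0) (𝓝 1) := by
  have hc : ContinuousAt (fun z ↦ z ^ 2 * ℘[L - (0 : ℂ)] z + 1) 0 :=
    ((continuousAt_id.pow 2).mul (L.analyticAt_weierstrassPExcept 0).continuousAt).add
      continuousAt_const
  have ht : Tendsto (fun z ↦ z ^ 2 * ℘[L - (0 : ℂ)] z + 1) (𝓝[≠] 0) (𝓝 1) := by
    simpa [ContinuousAt] using hc.tendsto.mono_left nhdsWithin_le_nhds
  refine ht.congr' ?_
  filter_upwards [self_mem_nhdsWithin] with z (hz : z ≠ 0)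
  have := L.ite_eq_one_sub_sq_mul_weierstrassP 0 (zero_mem _) z
  simpa [hz] using this.symm

/-- The function `z² h` extends analytically, vanishes at `0`, and is even, so its derivative
vanishes there too: it is divisible by `z²`. Evenness excludes a simple pole. -/
theorem exists_analyticAt_eq_of_even_of_tendsto {h : ℂ → ℂ} (heven : ∀ z, h (-z) = h z)
    (hd : ∀ᶠ z in 𝓝[≠] 0, DifferentiableAt ℂ h z)
    (ht : Tendsto (fun z ↦ z ^ 2 * h z) (𝓝[≠] 0) (𝓝 0)) :
    ∃ g : ℂ → ℂ, AnalyticAt ℂ g 0 ∧ ∀ᶠ z in 𝓝[≠] 0, h z = g z := by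
  set k : ℂ → ℂ := fun z ↦ z ^ 2 * h z with hk
  have hkc : ContinuousAt k 0 := by
    rw [continuousAt_iff_punctured_nhds]
    simpa [hk] using ht
  have hka : AnalyticAt ℂ k 0 := by
    refine Complex.analyticAt_of_differentiable_on_punctured_nhds_of_continuousAt ?_ hkc
    filter_upwards [hd] with z hz
    exact (differentiableAt_id.pow 2).mul hz
  have hkd : deriv k 0 = 0 := by
    have h1 : HasDerivAt k (deriv k 0) 0 := hka.differentiableAt.hasDerivAt
    have h2 : HasDerivAt (fun z ↦ k (-z)) (deriv k 0 * -1) 0 := by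
      have h3 : HasDerivAt k (deriv k 0) (-0) := by rwa [neg_zero]
      exact h3.comp (0 : ℂ) (hasDerivAt_neg (0 : ℂ))
    have h3 : (fun z ↦ k (-z)) = k := by
      ext z
      simp [hk, heven]
    rw [h3] at h2
    have := h1.unique h2
    linear_combination this / 2
  have ho : ((2 : ℕ) : ℕ∞) ≤ analyticOrderAt k 0 := by
    refine (natCast_le_analyticOrderAt_iff_iteratedDeriv_eq_zero hka).2 fun i hi ↦ ?_
    interval_cases i
    · simp [hk]
    · simpa using hkd
  obtain ⟨g, hg, hgk⟩ := (natCast_le_analyticOrderAt hka).1 ho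
  refine ⟨g, hg, ?_⟩
  filter_upwards [hgk.filter_mono nhdsWithin_le_nhds, self_mem_nhdsWithin] with z hz (hz0 : z ≠ 0)
  simp only [hk, sub_zero, smul_eq_mul] at hz
  exact mul_left_cancel₀ (pow_ne_zero 2 hz0) hz

theorem PeriodPair.eventually_notMem_lattice (L : PeriodPair) (x : ℂ) :
    ∀ᶠ z in 𝓝[≠] x, z ∉ L.lattice := by
  filter_upwards [self_mem_nhdsWithin,
    mem_nhdsWithin_of_mem_nhds (L.compl_lattice_sdiff_singleton_mem_nhds x)] with z hz hz'
  simp_all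

/-- The difference `W - ℘` has a removable singularity at `0`, hence at every lattice point. Once
filled in, it is entire and doubly periodic, so Liouville applies. -/
theorem PeriodPair.eq_weierstrassP_add_const (L : PeriodPair) {W : ℂ → ℂ}
    (hd : ∀ z ∉ L.lattice, DifferentiableAt ℂ W z)
    (hp : ∀ l ∈ L.lattice, Function.Periodic W l) (heven : ∀ z, W (-z) = W z)
    (ht : Tendsto (fun z ↦ z ^ 2 * W z) (𝓝[≠] 0) (𝓝 1)) :
    ∃ c, ∀ z ∉ L.lattice, W z = ℘[L] z + c := by
  classical
  have hPd : ∀ z ∉ L.lattice, DifferentiableAt ℂ ℘[L] z := fun z hz ↦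
    (L.analyticOnNhd_weierstrassP z hz).differentiableAt
  have hne := L.eventually_notMem_lattice 0
  obtain ⟨g, hg, hgh⟩ := exists_analyticAt_eq_of_even_of_tendsto
    (h := fun z ↦ W z - ℘[L] z) (fun z ↦ by rw [heven, L.weierstrassP_neg])
    (by filter_upwards [hne] with z hz using (hd z hz).sub (hPd z hz))
    (by
      have := ht.sub L.tendsto_sq_mul_weierstrassP
      rw [sub_self] at this
      exact this.congr fun z ↦ by ring)
  set H : ℂ → ℂ := fun z ↦ if z ∈ L.lattice then g 0 else W z - ℘[L] z with hH
  have hHp : ∀ z, ∀ l ∈ L.lattice, H (z + l) = H z := fun z l hl ↦ by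
    have h1 : z + l ∈ L.lattice ↔ z ∈ L.lattice := L.lattice.toAddSubgroup.add_mem_cancel_right hl
    have h2 := L.weierstrassP_add_coe z ⟨l, hl⟩
    simp only at h2
    simp only [hH, h1, hp l hl z, h2]
  have hH0 : DifferentiableAt ℂ H 0 := by
    refine hg.differentiableAt.congr_of_eventuallyEq ?_
    filter_upwards [eventually_nhdsWithin_iff.1 (hne.and hgh)] with z hz
    rcases eq_or_ne z 0 with rfl | hz0
    · simp [hH]
    · simp only [hH, (hz hz0).1, if_false, (hz hz0).2]
  have hHd : Differentiable ℂ H := fun z ↦ by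
    by_cases hz : z ∈ L.lattice
    · have h1 : H = fun w ↦ H (w - z) := by
        ext w
        rw [sub_eq_add_neg, hHp w (-z) (neg_mem hz)]
      rw [h1]
      have h2 : DifferentiableAt ℂ H (z - z) := by rwa [sub_self]
      exact h2.comp (f := fun w ↦ w - z) z (differentiableAt_id.sub_const z)
    · refine ((hd z hz).sub (hPd z hz)).congr_of_eventuallyEq ?_
      filter_upwards [L.isClosed_lattice.isOpen_compl.mem_nhds hz] with w hw
      have hw' : w ∉ L.lattice := hw
      simp [hH, hw']
  refine ⟨H 0, fun z hz ↦ ?_⟩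
  have := hHd.apply_eq_apply_of_bounded (IsZLattice.isCompact_range_of_periodic L.lattice _
    hHd.continuous fun z w hw ↦ hHp z w hw).isBounded z 0
  rw [← this]
  simp [hH, hz]

/-- A period off the lattice would carry continuity at `w` to the pole at `0`. -/
theorem PeriodPair.mem_lattice_of_periodic (L : PeriodPair) {w : ℂ}
    (hw : Function.Periodic ℘[L] w) : w ∈ L.lattice := by
  by_contra h
  have h1 : ContinuousAt ℘[L] w := (L.analyticOnNhd_weierstrassP w h).continuousAt
  refine L.not_continuousAt_weierstrassP 0 (zero_mem _) ?_
  have h2 : (fun z ↦ ℘[L] (z + w)) = ℘[L] := funext hw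
  rw [← h2]
  refine ContinuousAt.comp (f := fun z ↦ z + w) (g := ℘[L]) ?_ (by fun_prop)
  simpa using h1

theorem PeriodPair.periodic_weierstrassP_iff (L : PeriodPair) {w : ℂ} :
    Function.Periodic ℘[L] w ↔ w ∈ L.lattice :=
  ⟨L.mem_lattice_of_periodic, fun hw ↦ L.periodic_weierstrassP ⟨w, hw⟩⟩

theorem PeriodPair.meromorphicNFOn_weierstrassP (L : PeriodPair) :
    MeromorphicNFOn ℘[L] Set.univ := fun z _ ↦ by
  by_cases hz : z ∈ L.lattice
  · rw [meromorphicNFAt_iff_analyticAt_or]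
    refine .inr ⟨L.meromorphic_weierstrassP z, ?_, L.weierstrassP_coe ⟨z, hz⟩⟩
    rw [L.order_weierstrassP z hz]
    exact WithTop.coe_lt_coe.2 (by norm_num : (-2 : ℤ) < 0)
  · exact (L.analyticOnNhd_weierstrassP z hz).meromorphicNFAt

theorem MeromorphicNFOn.eq_of_frequently_eq {f g : ℂ → ℂ} (hf : MeromorphicNFOn f Set.univ)
    (hg : MeromorphicNFOn g Set.univ) {x : ℂ} (h : ∃ᶠ z in 𝓝[≠] x, f z = g z) : f = g := by
  have hm : Meromorphic (f - g) := fun z ↦ (hf (Set.mem_univ z)).meromorphicAt.sub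
    (hg (Set.mem_univ z)).meromorphicAt
  have hx : meromorphicOrderAt (f - g) x = ⊤ := by
    by_contra hne
    have := (meromorphicOrderAt_ne_top_iff_eventually_ne_zero (hm x)).1 hne
    obtain ⟨z, hz1, hz2⟩ := (h.and_eventually this).exists
    exact hz2 (by simp [hz1])
  ext z
  have hz : meromorphicOrderAt (f - g) z = ⊤ := by
    by_contra hne
    exact hm.exists_meromorphicOrderAt_ne_top_iff_forall.1 ⟨z, hne⟩ x hx
  have h1 : f =ᶠ[𝓝[≠] z] g := by
    filter_upwards [meromorphicOrderAt_eq_top_iff.1 hz] with w hw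
    exact sub_eq_zero.1 hw
  exact ((MeromorphicNFAt.eventuallyEq_nhdsNE_iff_eventuallyEq_nhds (hf (Set.mem_univ z))
    (hg (Set.mem_univ z))).1 h1).eq_of_nhds

theorem PeriodPair.tendsto_pow_three_mul_derivWeierstrassP (L : PeriodPair) :
    Tendsto (fun z ↦ z ^ 3 * ℘'[L] z) (𝓝[≠] 0) (𝓝 (-2)) := by
  have hc : ContinuousAt (fun z ↦ z ^ 3 * ℘'[L - (0 : ℂ)] z - 2) 0 :=
    ((continuousAt_id.pow 3).mul (L.analyticAt_derivWeierstrassPExcept 0).continuousAt).sub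
      continuousAt_const
  have ht : Tendsto (fun z ↦ z ^ 3 * ℘'[L - (0 : ℂ)] z - 2) (𝓝[≠] 0) (𝓝 (-2)) := by
    simpa [ContinuousAt] using hc.tendsto.mono_left nhdsWithin_le_nhds
  refine ht.congr' ?_
  filter_upwards [self_mem_nhdsWithin] with z (hz : z ≠ 0)
  have := L.derivWeierstrassPExcept_def ⟨0, zero_mem _⟩ z
  simp only [sub_zero] at this
  rw [this]
  field_simp
  ring

/-- Subtracting the two differential equations gives a linear equation for the difference `h`, which
is analytic at `0`. Its leading terms at `0` would force `h` to vanish to order `-3`, so `h`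
vanishes near `0`. -/
theorem PeriodPair.weierstrassP_eq_of_invariants_eq {L M : PeriodPair} (h₂ : L.g₂ = M.g₂)
    (h₃ : L.g₃ = M.g₃) : ℘[L] = ℘[M] := by
  set h : ℂ → ℂ := fun z ↦ ℘[L - (0 : ℂ)] z - ℘[M - (0 : ℂ)] z with hh
  have hha : AnalyticAt ℂ h 0 :=
    (L.analyticAt_weierstrassPExcept 0).sub (M.analyticAt_weierstrassPExcept 0)
  have heq : ∀ z, h z = ℘[L] z - ℘[M] z := fun z ↦ by
    have h1 := L.weierstrassPExcept_def ⟨0, zero_mem _⟩ z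
    have h2 := M.weierstrassPExcept_def ⟨0, zero_mem _⟩ z
    simp only at h1 h2
    rw [hh]
    simp only [h1, h2]
    ring
  have hde : ∀ᶠ z in 𝓝[≠] (0 : ℂ), z * deriv h z * (z ^ 3 * ℘'[L] z + z ^ 3 * ℘'[M] z) =
      h z * (4 * ((z ^ 2 * ℘[L] z) ^ 2 + (z ^ 2 * ℘[L] z) * (z ^ 2 * ℘[M] z) +
        (z ^ 2 * ℘[M] z) ^ 2) - z ^ 4 * L.g₂) := by
    filter_upwards [L.eventually_notMem_lattice 0, M.eventually_notMem_lattice 0] with z hL hM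
    have h1 := L.derivWeierstrassP_sq z hL
    have h2 := M.derivWeierstrassP_sq z hM
    have h3 : deriv h z = ℘'[L] z - ℘'[M] z := by
      rw [show h = fun z ↦ ℘[L] z - ℘[M] z from funext heq,
        deriv_fun_sub (L.analyticOnNhd_weierstrassP z hL).differentiableAt
          (M.analyticOnNhd_weierstrassP z hM).differentiableAt, L.deriv_weierstrassP,
        M.deriv_weierstrassP]
    rw [h3, heq]
    rw [← h₂, ← h₃] at h2
    linear_combination z ^ 4 * h1 - z ^ 4 * h2
  have hz0 : ∀ᶠ z in 𝓝 (0 : ℂ), h z = 0 := by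
    by_contra hne
    have ho : analyticOrderAt h 0 ≠ ⊤ := fun htop ↦ hne (analyticOrderAt_eq_top.1 htop)
    obtain ⟨n, hn⟩ := ENat.ne_top_iff_exists.1 ho
    obtain ⟨g, hg, hg0, hgh⟩ := (hha.analyticOrderAt_eq_natCast).1 hn.symm
    simp only [sub_zero, smul_eq_mul] at hgh
    have hgh' : h =ᶠ[𝓝 0] fun z ↦ z ^ n * g z := hgh
    have key : ∀ᶠ z in 𝓝[≠] (0 : ℂ),
        (n * g z + z * deriv g z) * (z ^ 3 * ℘'[L] z + z ^ 3 * ℘'[M] z) =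
      g z * (4 * ((z ^ 2 * ℘[L] z) ^ 2 + (z ^ 2 * ℘[L] z) * (z ^ 2 * ℘[M] z) +
        (z ^ 2 * ℘[M] z) ^ 2) - z ^ 4 * L.g₂) := by
      filter_upwards [hde, self_mem_nhdsWithin, hgh.filter_mono nhdsWithin_le_nhds,
        hgh'.eventuallyEq_nhds.filter_mono nhdsWithin_le_nhds,
        hg.eventually_analyticAt.filter_mono nhdsWithin_le_nhds] with z h1 (h2 : z ≠ 0) h3 h4 h5
      have h6 : deriv h z = n * z ^ (n - 1) * g z + z ^ n * deriv g z := by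
        rw [h4.deriv_eq]
        exact ((hasDerivAt_pow n z).mul h5.differentiableAt.hasDerivAt).deriv
      have h7 : z * (n * z ^ (n - 1) : ℂ) = n * z ^ n := by
        rcases n with _ | n
        · simp
        · simp only [Nat.add_sub_cancel]; ring
      rw [h6, h3] at h1
      apply mul_left_cancel₀ (pow_ne_zero n h2)
      linear_combination h1 - g z * (z ^ 3 * ℘'[L] z + z ^ 3 * ℘'[M] z) * h7
    have hid : Tendsto (fun z : ℂ ↦ z) (𝓝[≠] 0) (𝓝 0) := tendsto_id.mono_left nhdsWithin_le_nhds
    have hgt : Tendsto g (𝓝[≠] 0) (𝓝 (g 0)) :=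
      hg.continuousAt.tendsto.mono_left nhdsWithin_le_nhds
    have hgd : Tendsto (deriv g) (𝓝[≠] 0) (𝓝 (deriv g 0)) :=
      hg.deriv.continuousAt.tendsto.mono_left nhdsWithin_le_nhds
    have hPL := L.tendsto_sq_mul_weierstrassP
    have hPM := M.tendsto_sq_mul_weierstrassP
    have lhs := ((hgt.const_mul (n : ℂ)).add (hid.mul hgd)).mul
      (L.tendsto_pow_three_mul_derivWeierstrassP.add M.tendsto_pow_three_mul_derivWeierstrassP)
    have rhs := hgt.mul (((((hPL.pow 2).add (hPL.mul hPM)).add (hPM.pow 2)).const_mul 4).sub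
      ((hid.pow 4).mul_const L.g₂))
    have := tendsto_nhds_unique (lhs.congr' key) rhs
    -- The limits are `-2 - 2` for the two derivatives and `4 · 3` for the quadratic form.
    have h8 : g 0 * ((n : ℂ) + 3) = 0 := by linear_combination -this / 4
    rcases mul_eq_zero.1 h8 with h9 | h9
    · exact hg0 h9
    · have : ((n + 3 : ℕ) : ℂ) = 0 := by push_cast; exact h9
      exact absurd (Nat.cast_eq_zero.1 this) (by omega)
  refine L.meromorphicNFOn_weierstrassP.eq_of_frequently_eq M.meromorphicNFOn_weierstrassP (x := 0)
    (Eventually.frequently ?_)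
  filter_upwards [hz0.filter_mono nhdsWithin_le_nhds] with z hz
  rw [heq] at hz
  exact sub_eq_zero.1 hz

/-! ### Klein's formula: symmetries and holomorphy. -/

/-- The symmetric polarization of `orbitQuartic`. -/
noncomputable def orbitPolar (e x y : ℝ) : ℝ :=
  4 / 9 * (-(x ^ 2 * y ^ 2) - x * y * (x + y) + (x ^ 2 + 4 * x * y + y ^ 2) / 2 +
    (e ^ 3 + 3 * e ^ 2) / 2 * (x + y) - (e ^ 3 + 3 * e ^ 2))

/-- Klein's addition formula: the elliptic function of `u + i v` attached to a pair of real
motions. -/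
noncomputable def kleinSum (e : ℝ) (X X' Y Y' : ℝ → ℝ) (z : ℂ) : ℂ :=
  ((orbitPolar e (X z.re) (Y z.im) : ℝ) + Complex.I * (X' z.re * Y' z.im : ℝ)) /
    (2 * ((X z.re : ℂ) - Y z.im) ^ 2)

namespace IsOrbitPair

variable {e p q : ℝ} {X X' Y Y' : ℝ → ℝ}

theorem X'_neg (h : IsOrbitPair e p q X X' Y Y') (u : ℝ) : X' (-u) = -X' u := by
  have h1 : HasDerivAt (fun u ↦ X (-u)) (X' (-u) * -1) u := 
    (h.hasDerivAt_X (-u)).comp u (hasDerivAt_neg u)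
  rw [funext h.X_neg] at h1
  linarith [h1.unique (h.hasDerivAt_X u)]

theorem Y'_neg (h : IsOrbitPair e p q X X' Y Y') (u : ℝ) : Y' (-u) = -Y' u := by
  have h1 : HasDerivAt (fun u ↦ Y (-u)) (Y' (-u) * -1) u := 
    (h.hasDerivAt_Y (-u)).comp u (hasDerivAt_neg u)
  rw [funext h.Y_neg] at h1
  linarith [h1.unique (h.hasDerivAt_Y u)]

theorem periodic_X' (h : IsOrbitPair e p q X X' Y Y') : Function.Periodic X' p := fun u ↦ by
  have h1 : HasDerivAt (fun u ↦ X (u + p)) (X' (u + p)) u := 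
    (h.hasDerivAt_X (u + p)).comp_add_const u p
  rw [funext h.X_add] at h1
  exact h1.unique (h.hasDerivAt_X u)

theorem periodic_Y' (h : IsOrbitPair e p q X X' Y Y') : Function.Periodic Y' q := fun u ↦ by
  have h1 : HasDerivAt (fun u ↦ Y (u + q)) (Y' (u + q)) u := 
    (h.hasDerivAt_Y (u + q)).comp_add_const u q
  rw [funext h.Y_add] at h1
  exact h1.unique (h.hasDerivAt_Y u)

theorem X'_zero (h : IsOrbitPair e p q X X' Y Y') : X' 0 = 0 := by
  have := h.X'_neg 0
  rw [neg_zero] at this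
  linarith

theorem Y'_zero (h : IsOrbitPair e p q X X' Y Y') : Y' 0 = 0 := by
  have := h.Y'_neg 0
  rw [neg_zero] at this
  linarith

theorem X'_half (h : IsOrbitPair e p q X X' Y Y') : X' (p / 2) = 0 := by
  have := h.sq_X' (p / 2)
  rw [h.X_half, orbitQuartic, sub_self, mul_zero, zero_mul] at this
  exact pow_eq_zero_iff two_ne_zero |>.1 this

theorem kleinSum_neg (h : IsOrbitPair e p q X X' Y Y') (z : ℂ) :
    kleinSum e X X' Y Y' (-z) = kleinSum e X X' Y Y' z := by
  simp only [kleinSum, Complex.neg_re, Complex.neg_im, h.X_neg, h.Y_neg, h.X'_neg, h.Y'_neg,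
    neg_mul_neg]

theorem kleinSum_add (h : IsOrbitPair e p q X X' Y Y') (m n : ℤ) (z : ℂ) :
    kleinSum e X X' Y Y' (z + (m * p + n * (q * Complex.I))) = kleinSum e X X' Y Y' z := by
  have h1 : (z + (m * p + n * (q * Complex.I))).re = z.re + m * p := by simp
  have h2 : (z + (m * p + n * (q * Complex.I))).im = z.im + n * q := by simp
  simp only [kleinSum, h1, h2]
  rw [h.X_add.int_mul m, h.Y_add.int_mul n, h.periodic_X'.int_mul m, h.periodic_Y'.int_mul n]

theorem eq_of_X_eq_Y (h : IsOrbitPair e p q X X' Y Y') {u v : ℝ} (huv : X u = Y v) :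
    ∃ m n : ℤ, u = m * p ∧ v = n * q := by
  have h1 : X u = e := le_antisymm (huv ▸ h.Y_le v) (h.le_X u)
  obtain ⟨m, hm⟩ := h.X_eq u h1
  obtain ⟨n, hn⟩ := h.Y_eq v (huv ▸ h1)
  exact ⟨m, n, hm, hn⟩

theorem hasDerivAt_kleinSum_re (h : IsOrbitPair e p q X X' Y Y') {u v : ℝ} (huv : X u ≠ Y v) :
    HasDerivAt (fun t : ℝ ↦ kleinSum e X X' Y Y' (⟨t, v⟩ : ℂ))
      (((4 / 9 * (-(2 * X u * Y v ^ 2) - (2 * X u * Y v + Y v ^ 2) + (X u + 2 * Y v) +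
        (e ^ 3 + 3 * e ^ 2) / 2) * X' u + Complex.I * (orbitForce e (X u) * Y' v)) * (X u - Y v) -
        2 * (orbitPolar e (X u) (Y v) + Complex.I * (X' u * Y' v)) * X' u) /
        (2 * ((X u : ℂ) - Y v) ^ 3)) u := by
  have hne : (X u : ℂ) - Y v ≠ 0 := sub_ne_zero.2 (by exact_mod_cast huv)
  have hX := (h.hasDerivAt_X u).ofReal_comp
  have hX' := (h.hasDerivAt_X' u).ofReal_comp
  have hF : HasDerivAt (fun t : ℝ ↦ ((orbitPolar e (X t) (Y v) : ℝ) : ℂ)) _ u :=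
    (((((((h.hasDerivAt_X u).pow 2).mul_const (Y v ^ 2)).neg).sub
      (((h.hasDerivAt_X u).mul_const (Y v)).mul ((h.hasDerivAt_X u).add_const (Y v)))).add
      (((((h.hasDerivAt_X u).pow 2).add (((h.hasDerivAt_X u).const_mul 4).mul_const (Y v))).add_const
        (Y v ^ 2)).div_const 2)).add
      (((h.hasDerivAt_X u).add_const (Y v)).const_mul ((e ^ 3 + 3 * e ^ 2) / 2))
      |>.sub_const (e ^ 3 + 3 * e ^ 2) |>.const_mul (4 / 9)).ofReal_comp
  have hN := hF.add ((((h.hasDerivAt_X' u).mul_const (Y' v)).ofReal_comp).const_mul Complex.I)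
  have hD := ((hX.sub_const (Y v : ℂ)).pow 2).const_mul 2
  refine (hN.div hD (by simpa using hne)).congr_deriv ?_
  simp only [Pi.pow_apply, Pi.add_apply]
  push_cast
  field_simp
  ring

theorem hasDerivAt_kleinSum_im (h : IsOrbitPair e p q X X' Y Y') {u v : ℝ} (huv : X u ≠ Y v) :
    HasDerivAt (fun t : ℝ ↦ kleinSum e X X' Y Y' (⟨u, t⟩ : ℂ))
      (((4 / 9 * (-(2 * Y v * X u ^ 2) - (2 * X u * Y v + X u ^ 2) + (Y v + 2 * X u) +
        (e ^ 3 + 3 * e ^ 2) / 2) * Y' v + Complex.I * (X' u * -orbitForce e (Y v))) * (X u - Y v) +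
        2 * (orbitPolar e (X u) (Y v) + Complex.I * (X' u * Y' v)) * Y' v) /
        (2 * ((X u : ℂ) - Y v) ^ 3)) v := by
  have hne : (X u : ℂ) - Y v ≠ 0 := sub_ne_zero.2 (by exact_mod_cast huv)
  have hY := (h.hasDerivAt_Y v).ofReal_comp
  have hF : HasDerivAt (fun t : ℝ ↦ ((orbitPolar e (X u) (Y t) : ℝ) : ℂ)) _ v :=
    (((((((h.hasDerivAt_Y v).pow 2).const_mul (X u ^ 2)).neg).sub
      (((h.hasDerivAt_Y v).const_mul (X u)).mul ((h.hasDerivAt_Y v).const_add (X u)))).add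
      (((((h.hasDerivAt_Y v).const_mul (4 * X u)).const_add (X u ^ 2)).add
        ((h.hasDerivAt_Y v).pow 2)).div_const 2)).add
      (((h.hasDerivAt_Y v).const_add (X u)).const_mul ((e ^ 3 + 3 * e ^ 2) / 2))
      |>.sub_const (e ^ 3 + 3 * e ^ 2) |>.const_mul (4 / 9)).ofReal_comp
  have hN := hF.add ((((h.hasDerivAt_Y' v).const_mul (X' u)).ofReal_comp).const_mul Complex.I)
  have hD := ((hY.const_sub (X u : ℂ)).pow 2).const_mul 2
  refine (hN.div hD (by simpa using hne)).congr_deriv ?_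
  simp only [Pi.pow_apply, Pi.add_apply]
  push_cast
  field_simp
  ring

/-- Real differentiability is clear, so only Cauchy–Riemann matters: after clearing denominators it
is a polynomial identity modulo `X'² = f(X)`, `Y'² = -f(Y)` and `I² = -1`. -/
theorem differentiableAt_kleinSum (h : IsOrbitPair e p q X X' Y Y') {z : ℂ}
    (hz : X z.re ≠ Y z.im) : DifferentiableAt ℂ (kleinSum e X X' Y Y') z := by
  have hne : (X z.re : ℂ) - Y z.im ≠ 0 := sub_ne_zero.2 (by exact_mod_cast hz)
  have dre : DifferentiableAt ℝ Complex.re z := Complex.reCLM.differentiableAt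
  have dim : DifferentiableAt ℝ Complex.im z := Complex.imCLM.differentiableAt
  have hX : DifferentiableAt ℝ (fun w : ℂ ↦ X w.re) z :=
    (h.hasDerivAt_X z.re).differentiableAt.comp z dre
  have hX' : DifferentiableAt ℝ (fun w : ℂ ↦ X' w.re) z :=
    (h.hasDerivAt_X' z.re).differentiableAt.comp z dre
  have hY : DifferentiableAt ℝ (fun w : ℂ ↦ Y w.im) z :=
    (h.hasDerivAt_Y z.im).differentiableAt.comp z dim
  have hY' : DifferentiableAt ℝ (fun w : ℂ ↦ Y' w.im) z :=
    (h.hasDerivAt_Y' z.im).differentiableAt.comp z dim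
  have ofR : ∀ f : ℂ → ℝ, DifferentiableAt ℝ f z → DifferentiableAt ℝ (fun w ↦ (f w : ℂ)) z :=
    fun f hf ↦ Complex.ofRealCLM.differentiableAt.comp z hf
  have hpolar : ∀ a b : ℂ → ℝ, DifferentiableAt ℝ a z → DifferentiableAt ℝ b z →
      DifferentiableAt ℝ (fun w ↦ orbitPolar e (a w) (b w)) z := by
    intro a b ha hb
    unfold orbitPolar
    fun_prop
  have hd : DifferentiableAt ℝ (kleinSum e X X' Y Y') z := by
    unfold kleinSum
    simp only [div_eq_mul_inv]
    refine DifferentiableAt.mul ?_ (DifferentiableAt.fun_inv ?_ (by simpa using hne))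
    · refine (ofR (fun w ↦ orbitPolar e (X w.re) (Y w.im)) (hpolar _ _ hX hY)).add
        ((ofR (fun w ↦ X' w.re * Y' w.im) (hX'.mul hY')).const_mul _)
    · exact (((ofR _ hX).sub (ofR _ hY)).pow 2).const_mul 2
  rw [differentiableAt_complex_iff_differentiableAt_real]
  refine ⟨hd, ?_⟩
  have hf := hd.hasFDerivAt
  have l1 : HasDerivAt (fun t : ℝ ↦ (⟨t, z.im⟩ : ℂ)) 1 z.re := by
    have : HasDerivAt (fun t : ℝ ↦ (t : ℂ) + z.im * Complex.I) 1 z.re :=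
      (hasDerivAt_id z.re).ofReal_comp.add_const _
    convert this using 2 with t
    exact Complex.mk_eq_add_mul_I t z.im
  have l2 : HasDerivAt (fun t : ℝ ↦ (⟨z.re, t⟩ : ℂ)) Complex.I z.im := by
    have : HasDerivAt (fun t : ℝ ↦ (z.re : ℂ) + t * Complex.I) (1 * Complex.I) z.im :=
      ((hasDerivAt_id z.im).ofReal_comp.mul_const _).const_add _
    rw [one_mul] at this
    convert this using 2 with t
    exact Complex.mk_eq_add_mul_I z.re t
  have e1 := (hf.comp_hasDerivAt (f := fun t : ℝ ↦ (⟨t, z.im⟩ : ℂ)) z.re l1).unique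
    (h.hasDerivAt_kleinSum_re hz)
  have e2 := (hf.comp_hasDerivAt (f := fun t : ℝ ↦ (⟨z.re, t⟩ : ℂ)) z.im l2).unique
    (h.hasDerivAt_kleinSum_im hz)
  rw [e1, e2, smul_eq_mul, ← mul_div_assoc]
  congr 1
  have f1 : ((X' z.re : ℂ)) ^ 2 = (orbitQuartic e (X z.re) : ℝ) := by exact_mod_cast h.sq_X' z.re
  have f2 : ((Y' z.im : ℂ)) ^ 2 = (-orbitQuartic e (Y z.im) : ℝ) := by
    exact_mod_cast h.sq_Y' z.im
  simp only [orbitQuartic, orbitForce, orbitPolar] at *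
  push_cast at *
  generalize (X z.re : ℂ) = x at *
  generalize (Y z.im : ℂ) = y at *
  generalize (X' z.re : ℂ) = x1 at *
  generalize (Y' z.im : ℂ) = y1 at *
  have hI := Complex.I_sq
  linear_combination (-2 * y1) * f1 + 2 * Complex.I * x1 * f2 + (2 * y1 * x1 ^ 2 - 2 / 9 *
    (-(x ^ 3 + 3 * x ^ 2 - e ^ 3 - 3 * e ^ 2) + (1 - x) * (3 * x ^ 2 + 6 * x)) * y1 * (x - y)) * hI

end IsOrbitPair

/-! ### The double pole of the Klein sum at the origin. -/

theorem Filter.Tendsto.trans_eq {α β : Type*} [TopologicalSpace β] {l : Filter α} {f : α → β}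
    {a b : β} (h : Tendsto f l (𝓝 a)) (hab : a = b) : Tendsto f l (𝓝 b) :=
  hab ▸ h

theorem tendsto_mul_zero_of_abs_le_one {α : Type*} {l : Filter α} {f g : α → ℝ}
    (hf : Tendsto f l (𝓝 0)) (hg : ∀ x, |g x| ≤ 1) : Tendsto (fun x ↦ f x * g x) l (𝓝 0) := by
  refine squeeze_zero_norm (fun x ↦ ?_) (by simpa using hf.abs)
  rw [norm_mul, Real.norm_eq_abs, Real.norm_eq_abs]
  exact mul_le_of_le_one_right (abs_nonneg _) (hg x)

theorem Complex.abs_sq_re_div_normSq_le (z : ℂ) : |z.re ^ 2 / Complex.normSq z| ≤ 1 := by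
  rw [abs_of_nonneg (div_nonneg (sq_nonneg _) (Complex.normSq_nonneg z))]
  refine div_le_one_of_le₀ ?_ (Complex.normSq_nonneg z)
  rw [Complex.normSq_apply]
  nlinarith [sq_nonneg z.im]

theorem Complex.abs_sq_im_div_normSq_le (z : ℂ) : |z.im ^ 2 / Complex.normSq z| ≤ 1 := by
  rw [abs_of_nonneg (div_nonneg (sq_nonneg _) (Complex.normSq_nonneg z))]
  refine div_le_one_of_le₀ ?_ (Complex.normSq_nonneg z)
  rw [Complex.normSq_apply]
  nlinarith [sq_nonneg z.re]

theorem Complex.abs_re_mul_im_div_normSq_le (z : ℂ) :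
    |z.re * z.im / Complex.normSq z| ≤ 1 := by
  rw [abs_div, abs_of_nonneg (Complex.normSq_nonneg z)]
  refine div_le_one_of_le₀ ?_ (Complex.normSq_nonneg z)
  rw [Complex.normSq_apply, abs_le]
  constructor <;> nlinarith [sq_nonneg (z.re + z.im), sq_nonneg (z.re - z.im), sq_nonneg z.re,
    sq_nonneg z.im]

/-- The cofactor of `x - e` in `orbitQuartic e x`. -/
noncomputable def orbitCofactor (e x : ℝ) : ℝ :=
  4 / 9 * (1 - x) * (x ^ 2 + (e + 3) * x + e * (e + 3))

/-- Half the slope of `orbitForce e` acting at the turning point `e`. -/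
noncomputable def turningRate (e : ℝ) : ℝ :=
  1 / 3 * e * (1 - e) * (e + 2)

theorem orbitQuartic_eq_mul (e x : ℝ) : orbitQuartic e x = (x - e) * orbitCofactor e x := by
  rw [orbitQuartic, orbitCofactor]; ring

namespace IsOrbitPair

variable {e p q : ℝ} {X X' Y Y' : ℝ → ℝ}

theorem turningRate_pos (h : IsOrbitPair e p q X X' Y Y') : 0 < turningRate e := by
  have := h.e_pos
  have := h.e_lt_one
  have : 0 < 1 - e := by linarith
  unfold turningRate
  positivity

/-- Writing `X' = u P`, the energy law divided by the nonvanishing cofactor gives `X - e` exactly as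
a multiple of `u²`, without a second-order Taylor expansion. -/
theorem exists_X_sub_eq (h : IsOrbitPair e p q X X' Y Y') :
    ∃ P α : ℝ → ℝ, Tendsto P (𝓝 0) (𝓝 (2 * turningRate e)) ∧
      Tendsto α (𝓝 0) (𝓝 (turningRate e)) ∧ (∀ u, X' u = u * P u) ∧
      ∀ᶠ u in 𝓝 0, X u - e = α u * u ^ 2 := by
  have hA := h.turningRate_pos
  have hd := h.hasDerivAt_X' 0
  have hf : orbitForce e (X 0) = 2 * turningRate e := by
    rw [h.X_zero, orbitForce, turningRate]; ring
  have hP : Tendsto (dslope X' 0) (𝓝 0) (𝓝 (2 * turningRate e)) := by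
    have := (continuousAt_dslope_same.2 hd.differentiableAt).tendsto
    rwa [dslope_same, hd.deriv, hf] at this
  have hXP : ∀ u, X' u = u * dslope X' 0 u := fun u ↦ by
    simpa [h.X'_zero] using (sub_smul_dslope X' 0 u).symm
  have hc : Tendsto (fun u ↦ orbitCofactor e (X u)) (𝓝 0) (𝓝 (4 * turningRate e)) := by
    have h1 : ContinuousAt (fun u ↦ orbitCofactor e (X u)) 0 := by
      have := (h.hasDerivAt_X 0).continuousAt
      unfold orbitCofactor
      fun_prop
    have h2 : orbitCofactor e (X 0) = 4 * turningRate e := by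
      rw [h.X_zero, orbitCofactor, turningRate]; ring
    rw [← h2]
    exact h1.tendsto
  refine ⟨dslope X' 0, fun u ↦ dslope X' 0 u ^ 2 / orbitCofactor e (X u), hP, ?_, hXP, ?_⟩
  · refine ((hP.pow 2).div hc (by positivity)).trans_eq ?_
    field_simp
    norm_num
  · filter_upwards [hc.eventually_ne (by positivity : 4 * turningRate e ≠ 0)] with u hu
    have h3 := h.sq_X' u
    rw [orbitQuartic_eq_mul, hXP] at h3
    field_simp
    linarith

theorem exists_Y_sub_eq (h : IsOrbitPair e p q X X' Y Y') :
    ∃ R β : ℝ → ℝ, Tendsto R (𝓝 0) (𝓝 (-(2 * turningRate e))) ∧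
      Tendsto β (𝓝 0) (𝓝 (turningRate e)) ∧ (∀ v, Y' v = v * R v) ∧
      ∀ᶠ v in 𝓝 0, Y v - e = -(β v * v ^ 2) := by
  have hA := h.turningRate_pos
  have hd := h.hasDerivAt_Y' 0
  have hf : -orbitForce e (Y 0) = -(2 * turningRate e) := by
    rw [h.Y_zero, orbitForce, turningRate]; ring
  have hP : Tendsto (dslope Y' 0) (𝓝 0) (𝓝 (-(2 * turningRate e))) := by
    have := (continuousAt_dslope_same.2 hd.differentiableAt).tendsto
    rwa [dslope_same, hd.deriv, hf] at this
  have hXP : ∀ u, Y' u = u * dslope Y' 0 u := fun u ↦ by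
    simpa [h.Y'_zero] using (sub_smul_dslope Y' 0 u).symm
  have hc : Tendsto (fun u ↦ orbitCofactor e (Y u)) (𝓝 0) (𝓝 (4 * turningRate e)) := by
    have h1 : ContinuousAt (fun u ↦ orbitCofactor e (Y u)) 0 := by
      have := (h.hasDerivAt_Y 0).continuousAt
      unfold orbitCofactor
      fun_prop
    have h2 : orbitCofactor e (Y 0) = 4 * turningRate e := by
      rw [h.Y_zero, orbitCofactor, turningRate]; ring
    rw [← h2]
    exact h1.tendsto
  refine ⟨dslope Y' 0, fun u ↦ dslope Y' 0 u ^ 2 / orbitCofactor e (Y u), hP, ?_, hXP, ?_⟩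
  · refine ((hP.pow 2).div hc (by positivity)).trans_eq ?_
    field_simp
    norm_num
  · filter_upwards [hc.eventually_ne (by positivity : 4 * turningRate e ≠ 0)] with u hu
    have h3 := h.sq_Y' u
    rw [orbitQuartic_eq_mul, hXP] at h3
    field_simp
    linarith

/-- With `X ≈ e + Au²` and `Y ≈ e - Av²`, the numerator is about `2A² z̄²` and `X - Y` about
`A|z|²`, so the quotient is about `1/z²`. Errors are null functions times the bounded ratios
`u²/|z|²`, `v²/|z|²`, `uv/|z|²`. -/
theorem tendsto_sq_mul_kleinSum (h : IsOrbitPair e p q X X' Y Y') :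
    Tendsto (fun z ↦ z ^ 2 * kleinSum e X X' Y Y' z) (𝓝[≠] 0) (𝓝 1) := by
  obtain ⟨P, α, hP, hα, hXP, hXα⟩ := h.exists_X_sub_eq
  obtain ⟨R, β, hR, hβ, hYR, hYβ⟩ := h.exists_Y_sub_eq
  have hA := h.turningRate_pos
  obtain ⟨A, hAdef⟩ : ∃ A, A = turningRate e := ⟨_, rfl⟩
  rw [← hAdef] at hP hα hR hβ hA
  have hre : Tendsto Complex.re (𝓝[≠] 0) (𝓝 0) := by
    simpa using (Complex.continuous_re.tendsto 0).mono_left nhdsWithin_le_nhds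
  have him : Tendsto Complex.im (𝓝[≠] 0) (𝓝 0) := by
    simpa using (Complex.continuous_im.tendsto 0).mono_left nhdsWithin_le_nhds
  have tX : Tendsto (fun z : ℂ ↦ X z.re) (𝓝[≠] 0) (𝓝 e) := by
    rw [← h.X_zero]
    exact (h.hasDerivAt_X 0).continuousAt.tendsto.comp hre
  have tY : Tendsto (fun z : ℂ ↦ Y z.im) (𝓝[≠] 0) (𝓝 e) := by
    rw [← h.Y_zero]
    exact (h.hasDerivAt_Y 0).continuousAt.tendsto.comp him
  -- `G` and `K` are divided differences of the polarization, which vanishes at `(e, e)`. Both tend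
  -- to its partial derivative there, `f'(e)/2 = 2A`.
  obtain ⟨G, hG⟩ : ∃ G : ℂ → ℝ, G = fun z ↦ 4 / 9 * (-((X z.re + e) * Y z.im ^ 2) -
    Y z.im * (X z.re + e) - Y z.im ^ 2 + (X z.re + e) / 2 + 2 * Y z.im +
    (e ^ 3 + 3 * e ^ 2) / 2) := ⟨_, rfl⟩
  obtain ⟨K, hK⟩ : ∃ K : ℂ → ℝ, K = fun z ↦ 4 / 9 * (-((Y z.im + e) * e ^ 2) -
    e * (Y z.im + e) - e ^ 2 + (Y z.im + e) / 2 + 2 * e +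
    (e ^ 3 + 3 * e ^ 2) / 2) := ⟨_, rfl⟩
  have hGK : ∀ z : ℂ, orbitPolar e (X z.re) (Y z.im) =
      G z * (X z.re - e) + K z * (Y z.im - e) := fun z ↦ by
    rw [hG, hK, orbitPolar]
    ring
  have tG : Tendsto G (𝓝[≠] 0) (𝓝 (2 * A)) := by
    have hc : Continuous fun w : ℝ × ℝ ↦ 4 / 9 * (-((w.1 + e) * w.2 ^ 2) -
      w.2 * (w.1 + e) - w.2 ^ 2 + (w.1 + e) / 2 + 2 * w.2 + (e ^ 3 + 3 * e ^ 2) / 2) := by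
      fun_prop
    rw [hG]
    refine ((hc.tendsto (e, e)).comp (tX.prodMk_nhds tY)).trans_eq ?_
    simp only
    rw [hAdef, turningRate]
    ring
  have tK : Tendsto K (𝓝[≠] 0) (𝓝 (2 * A)) := by
    have hc : Continuous fun y : ℝ ↦ 4 / 9 * (-((y + e) * e ^ 2) -
      e * (y + e) - e ^ 2 + (y + e) / 2 + 2 * e + (e ^ 3 + 3 * e ^ 2) / 2) := by
      fun_prop
    rw [hK]
    refine ((hc.tendsto e).comp tY).trans_eq ?_
    rw [hAdef, turningRate]
    ring
  have tGα : Tendsto (fun z : ℂ ↦ G z * α z.re - 2 * A ^ 2) (𝓝[≠] 0) (𝓝 0) :=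
    ((tG.mul (hα.comp hre)).sub_const (2 * A ^ 2)).trans_eq (by ring)
  have tKβ : Tendsto (fun z : ℂ ↦ K z * β z.im - 2 * A ^ 2) (𝓝[≠] 0) (𝓝 0) :=
    ((tK.mul (hβ.comp him)).sub_const (2 * A ^ 2)).trans_eq (by ring)
  have tPR : Tendsto (fun z : ℂ ↦ P z.re * R z.im + 4 * A ^ 2) (𝓝[≠] 0) (𝓝 0) :=
    (((hP.comp hre).mul (hR.comp him)).add_const (4 * A ^ 2)).trans_eq (by ring)
  have tα : Tendsto (fun z : ℂ ↦ α z.re - A) (𝓝[≠] 0) (𝓝 0) := by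
    simpa using (hα.comp hre).sub_const A
  have tβ : Tendsto (fun z : ℂ ↦ β z.im - A) (𝓝[≠] 0) (𝓝 0) := by
    simpa using (hβ.comp him).sub_const A
  have tD : Tendsto (fun z : ℂ ↦ A + (α z.re - A) * (z.re ^ 2 / Complex.normSq z) +
      (β z.im - A) * (z.im ^ 2 / Complex.normSq z)) (𝓝[≠] 0) (𝓝 A) := by
    simpa using (tendsto_const_nhds (x := A)).add
      (tendsto_mul_zero_of_abs_le_one tα Complex.abs_sq_re_div_normSq_le) |>.add
      (tendsto_mul_zero_of_abs_le_one tβ Complex.abs_sq_im_div_normSq_le)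
  have tE₁ : Tendsto (fun z : ℂ ↦ (G z * α z.re - 2 * A ^ 2) * (z.re ^ 2 / Complex.normSq z) -
      (K z * β z.im - 2 * A ^ 2) * (z.im ^ 2 / Complex.normSq z)) (𝓝[≠] 0) (𝓝 0) := by
    simpa using (tendsto_mul_zero_of_abs_le_one tGα Complex.abs_sq_re_div_normSq_le).sub
      (tendsto_mul_zero_of_abs_le_one tKβ Complex.abs_sq_im_div_normSq_le)
  have tE₂ := tendsto_mul_zero_of_abs_le_one tPR Complex.abs_re_mul_im_div_normSq_le
  obtain ⟨D, hD⟩ : ∃ D : ℂ → ℝ, D = fun z : ℂ ↦ A + (α z.re - A) * (z.re ^ 2 / Complex.normSq z) +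
      (β z.im - A) * (z.im ^ 2 / Complex.normSq z) := ⟨_, rfl⟩
  obtain ⟨E₁, hE₁⟩ : ∃ E : ℂ → ℝ, E = fun z : ℂ ↦
      (G z * α z.re - 2 * A ^ 2) * (z.re ^ 2 / Complex.normSq z) -
      (K z * β z.im - 2 * A ^ 2) * (z.im ^ 2 / Complex.normSq z) := ⟨_, rfl⟩
  obtain ⟨E₂, hE₂⟩ : ∃ E : ℂ → ℝ, E = fun z : ℂ ↦
      (P z.re * R z.im + 4 * A ^ 2) * (z.re * z.im / Complex.normSq z) := ⟨_, rfl⟩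
  rw [← hD] at tD
  rw [← hE₁] at tE₁
  rw [← hE₂] at tE₂
  have tDc : Tendsto (fun z ↦ (D z : ℂ)) (𝓝[≠] 0) (𝓝 (A : ℂ)) :=
    (Complex.continuous_ofReal.tendsto A).comp tD
  have tEc : Tendsto (fun z ↦ (E₁ z : ℂ) + Complex.I * E₂ z) (𝓝[≠] 0) (𝓝 0) := by
    have h1 := (Complex.continuous_ofReal.tendsto 0).comp tE₁
    have h2 := (Complex.continuous_ofReal.tendsto 0).comp tE₂
    simpa using h1.add (h2.const_mul Complex.I)
  have tE : Tendsto (fun z : ℂ ↦ z ^ 2 / Complex.normSq z * ((E₁ z : ℂ) + Complex.I * E₂ z))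
      (𝓝[≠] 0) (𝓝 0) := by
    refine squeeze_zero_norm (fun z ↦ ?_) (by simpa using tEc.norm)
    rw [norm_mul]
    refine mul_le_of_le_one_left (norm_nonneg _) ?_
    rw [norm_div, norm_pow, Complex.norm_real, Complex.normSq_eq_norm_sq,
      Real.norm_of_nonneg (by positivity)]
    exact div_self_le_one _
  have hAc : (A : ℂ) ≠ 0 := by exact_mod_cast hA.ne'
  have tfinal := ((tendsto_const_nhds (x := (2 * (A : ℂ) ^ 2))).add tE).div
    ((tDc.pow 2).const_mul 2) (by simpa using hAc)
  rw [add_zero, div_self (by simpa using hAc)] at tfinal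
  refine tfinal.congr' ?_
  have hα' := hre.eventually hXα
  have hβ' := him.eventually hYβ
  filter_upwards [hα', hβ', self_mem_nhdsWithin] with z h1 h2 (hz : z ≠ 0)
  have hn : Complex.normSq z ≠ 0 := by simpa using hz
  have hnz : Complex.normSq z = z.re ^ 2 + z.im ^ 2 := by rw [Complex.normSq_apply]; ring
  have hDn : X z.re - Y z.im = D z * Complex.normSq z := by
    rw [hD]
    field_simp
    rw [hnz]
    linear_combination h1 - h2
  have hF : orbitPolar e (X z.re) (Y z.im) =
      2 * A ^ 2 * (z.re ^ 2 - z.im ^ 2) + E₁ z * Complex.normSq z := by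
    rw [hGK, h1, h2, hE₁]
    field_simp
    ring
  have hXY : X' z.re * Y' z.im = -(4 * A ^ 2 * (z.re * z.im)) + E₂ z * Complex.normSq z := by
    rw [hXP, hYR, hE₂]
    field_simp
    ring
  have hzz : z = z.re + z.im * Complex.I := (Complex.re_add_im z).symm
  have hDc : (X z.re : ℂ) - Y z.im = D z * Complex.normSq z := by exact_mod_cast hDn
  rw [kleinSum, hDc, hF, hXY]
  have hnc : (Complex.normSq z : ℂ) ≠ 0 := by exact_mod_cast hn
  have hz4 : z ^ 2 * (2 * A ^ 2 * ((z.re : ℂ) ^ 2 - z.im ^ 2) +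
      Complex.I * -(4 * A ^ 2 * (z.re * z.im))) = 2 * A ^ 2 * (Complex.normSq z : ℂ) ^ 2 := by
    rw [← Complex.mul_conj]
    have hcj : (starRingEnd ℂ) z = z.re - z.im * Complex.I := by
      apply Complex.ext <;> simp
    rw [mul_pow, hcj]
    linear_combination 2 * (A : ℂ) ^ 2 * z ^ 2 * (z.im : ℂ) ^ 2 * Complex.I_sq * (-1)
  push_cast
  simp only [Pi.div_apply]
  -- Where `D` vanishes, both sides are `0` by the convention for division.
  by_cases hD0 : (D z : ℂ) = 0
  · simp [hD0]
  · rw [← mul_div_assoc, div_eq_div_iff (by simpa using hD0) (by simp [hD0, hnc])]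
    field_simp
    linear_combination (-1) * hz4

end IsOrbitPair

/-! ### The rectangular lattice and its invariants. -/

/-- The rectangular period pair with sides `p` and `q`. -/
noncomputable def PeriodPair.rectangular (p q : ℝ) (hp : 0 < p) (hq : 0 < q) : PeriodPair where
  ω₁ := p
  ω₂ := q * Complex.I
  indep := by
    rw [LinearIndependent.pair_iff]
    intro s t h
    have h1 := congrArg Complex.re h
    have h2 := congrArg Complex.im h
    simp at h1 h2
    exact ⟨h1.resolve_right hp.ne', h2.resolve_right hq.ne'⟩

theorem PeriodPair.mem_lattice_rectangular {p q : ℝ} {hp : 0 < p} {hq : 0 < q} {z : ℂ} :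
    z ∈ (PeriodPair.rectangular p q hp hq).lattice ↔
      ∃ m n : ℤ, z = m * p + n * (q * Complex.I) := by
  rw [PeriodPair.mem_lattice]
  simp only [PeriodPair.rectangular, eq_comm]

theorem coeff_eq_zero_of_three_roots {a b d x y z : ℂ} (hxy : x ≠ y) (hyz : y ≠ z) (hxz : x ≠ z)
    (hx : a * x ^ 2 + b * x + d = 0) (hy : a * y ^ 2 + b * y + d = 0)
    (hz : a * z ^ 2 + b * z + d = 0) : a = 0 ∧ b = 0 ∧ d = 0 := by
  have h1 : a * (x + y) + b = 0 := by
    apply mul_left_cancel₀ (sub_ne_zero.2 hxy)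
    linear_combination hx - hy
  have h2 : a * (y + z) + b = 0 := by
    apply mul_left_cancel₀ (sub_ne_zero.2 hyz)
    linear_combination hy - hz
  have ha : a = 0 := by
    apply mul_left_cancel₀ (sub_ne_zero.2 hxz)
    linear_combination h1 - h2
  subst ha
  have hb : b = 0 := by linear_combination h1
  subst hb
  exact ⟨rfl, rfl, by linear_combination hx⟩

namespace IsOrbitPair

variable {e p q : ℝ} {X X' Y Y' : ℝ → ℝ}

/-- The lattice of periods attached to a pair of motions. -/
noncomputable def periodPair (h : IsOrbitPair e p q X X' Y Y') : PeriodPair :=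
  PeriodPair.rectangular p q h.p_pos h.q_pos

theorem mem_lattice (h : IsOrbitPair e p q X X' Y Y') {z : ℂ} :
    z ∈ h.periodPair.lattice ↔ ∃ m n : ℤ, z = m * p + n * (q * Complex.I) :=
  PeriodPair.mem_lattice_rectangular

theorem X_ne_Y (h : IsOrbitPair e p q X X' Y Y') {z : ℂ} (hz : z ∉ h.periodPair.lattice) :
    X z.re ≠ Y z.im := fun hXY ↦ hz <| by
  obtain ⟨m, n, hm, hn⟩ := h.eq_of_X_eq_Y hXY
  refine h.mem_lattice.2 ⟨m, n, ?_⟩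
  apply Complex.ext <;> simp [hm, hn]

theorem notMem_lattice_of_X_ne (h : IsOrbitPair e p q X X' Y Y') {z : ℂ} (hz : X z.re ≠ e) :
    z ∉ h.periodPair.lattice := fun hm ↦ hz <| by
  obtain ⟨m, n, rfl⟩ := h.mem_lattice.1 hm
  have := h.X_add.int_mul m 0
  simpa [h.X_zero] using this

theorem exists_kleinSum_eq (h : IsOrbitPair e p q X X' Y Y') :
    ∃ c, ∀ z ∉ h.periodPair.lattice, kleinSum e X X' Y Y' z = ℘[h.periodPair] z + c :=
  h.periodPair.eq_weierstrassP_add_const (fun _ hz ↦ h.differentiableAt_kleinSum (h.X_ne_Y hz))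
    (fun l hl z ↦ by
      obtain ⟨m, n, rfl⟩ := h.mem_lattice.1 hl
      exact h.kleinSum_add m n z)
    h.kleinSum_neg h.tendsto_sq_mul_kleinSum

theorem one_sub_Y_pos (h : IsOrbitPair e p q X X' Y Y') (v : ℝ) : 0 < 1 - Y v := by
  linarith [h.Y_le v, h.e_lt_one]

/-- Since `1` is a root of the quartic, the polarization at `X = 1` is divisible by `1 - Y`, leaving
a Möbius function of `Y`. -/
theorem kleinSum_half (h : IsOrbitPair e p q X X' Y Y') (v : ℝ) :
    kleinSum e X X' Y Y' (p / 2 + v * Complex.I) =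
      (-(1 / 3) + (1 - e) * (e + 2) ^ 2 / 9 / (1 - Y v) : ℝ) := by
  have h1 : ((p : ℂ) / 2 + v * Complex.I).re = p / 2 := by simp
  have h2 : ((p : ℂ) / 2 + v * Complex.I).im = v := by simp
  rw [kleinSum, h1, h2, h.X_half, h.X'_half, zero_mul, Complex.ofReal_zero, mul_zero, add_zero,
    orbitPolar]
  norm_cast
  have := (h.one_sub_Y_pos v).ne'
  field_simp
  ring

/-- Along `Re z = p/2`, which misses the lattice, `℘ = Q - c`. The energy law for `Y` gives a
Weierstrass equation for `Q` with the desired coefficients; comparison with the equation for `℘`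
leaves a quadratic in `Q` with leading coefficient `-12c`. It vanishes at three distinct values,
hence identically. -/
theorem invariants (h : IsOrbitPair e p q X X' Y Y') {κ : ℝ}
    (hκ : 4 * κ ^ 2 = (1 - e) * (e + 2) ^ 2) :
    h.periodPair.g₂ = 4 / 27 * (9 - 8 * (κ : ℂ) ^ 2) ∧
    h.periodPair.g₃ = 8 / 729 * (27 - 36 * (κ : ℂ) ^ 2 + 8 * (κ : ℂ) ^ 4) ∧
    ∀ z ∉ h.periodPair.lattice, kleinSum e X X' Y Y' z = ℘[h.periodPair] z := by
  obtain ⟨c, hc⟩ := h.exists_kleinSum_eq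
  obtain ⟨Q, hQ⟩ : ∃ Q : ℝ → ℝ, Q = fun v ↦
    -(1 / 3) + (1 - e) * (e + 2) ^ 2 / 9 / (1 - Y v) := ⟨_, rfl⟩
  have hnm : ∀ v : ℝ, ((p : ℂ) / 2 + v * Complex.I) ∉ h.periodPair.lattice := fun v ↦ by
    apply h.notMem_lattice_of_X_ne
    have h1 : ((p : ℂ) / 2 + v * Complex.I).re = p / 2 := by simp
    rw [h1, h.X_half]
    exact h.e_lt_one.ne'
  have hP : ∀ v : ℝ, ℘[h.periodPair] (p / 2 + v * Complex.I) = Q v - c := fun v ↦ by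
    have := hc _ (hnm v)
    rw [h.kleinSum_half] at this
    rw [hQ]
    linear_combination -this
  have hQd : ∀ v, HasDerivAt Q ((1 - e) * (e + 2) ^ 2 / 9 * Y' v / (1 - Y v) ^ 2) v := fun v ↦ by
    rw [hQ]
    have := (h.one_sub_Y_pos v).ne'
    refine (((hasDerivAt_const v _).div ((h.hasDerivAt_Y v).const_sub 1) this).const_add
      _).congr_deriv ?_
    field_simp
    ring
  have hPd : ∀ v : ℝ, ℘'[h.periodPair] (p / 2 + v * Complex.I) * Complex.I =
      ((1 - e) * (e + 2) ^ 2 / 9 * Y' v / (1 - Y v) ^ 2 : ℝ) := fun v ↦ by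
    have h1 : HasDerivAt (fun t : ℝ ↦ (p : ℂ) / 2 + t * Complex.I) (1 * Complex.I) v :=
      ((hasDerivAt_id v).ofReal_comp.mul_const _).const_add _
    rw [one_mul] at h1
    have h2 := ((h.periodPair.analyticOnNhd_weierstrassP _ (hnm v)).differentiableAt).hasDerivAt
    rw [h.periodPair.deriv_weierstrassP] at h2
    have h3 := h2.comp v h1
    rw [show (℘[h.periodPair] ∘ fun t : ℝ ↦ (p : ℂ) / 2 + t * Complex.I) =
      fun t ↦ (Q t : ℂ) - c from funext hP] at h3
    exact h3.unique ((hQd v).ofReal_comp.sub_const c)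
  have hQ2 : ∀ v, ((1 - e) * (e + 2) ^ 2 / 9 * Y' v / (1 - Y v) ^ 2) ^ 2 =
      -(4 * Q v ^ 3 - 4 / 27 * (9 - 8 * κ ^ 2) * Q v -
        8 / 729 * (27 - 36 * κ ^ 2 + 8 * κ ^ 4)) := fun v ↦ by
    have h1 := h.sq_Y' v
    have h2 := (h.one_sub_Y_pos v).ne'
    rw [div_pow, mul_pow, h1, hQ, orbitQuartic, show κ ^ 4 = (κ ^ 2) ^ 2 by ring,
      show κ ^ 2 = (1 - e) * (e + 2) ^ 2 / 4 by linarith]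
    field_simp
    ring
  have key : ∀ v : ℝ, (-12 * c) * (Q v : ℂ) ^ 2 + (12 * c ^ 2 - h.periodPair.g₂ +
      4 / 27 * (9 - 8 * (κ : ℂ) ^ 2)) * Q v + (-4 * c ^ 3 + h.periodPair.g₂ * c -
      h.periodPair.g₃ + 8 / 729 * (27 - 36 * (κ : ℂ) ^ 2 + 8 * (κ : ℂ) ^ 4)) = 0 := fun v ↦ by
    have h1 := h.periodPair.derivWeierstrassP_sq _ (hnm v)
    have h2 := hPd v
    have h3 : ((((1 - e) * (e + 2) ^ 2 / 9 * Y' v / (1 - Y v) ^ 2 : ℝ) : ℂ)) ^ 2 =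
      -(4 * (Q v : ℂ) ^ 3 - 4 / 27 * (9 - 8 * (κ : ℂ) ^ 2) * Q v -
        8 / 729 * (27 - 36 * (κ : ℂ) ^ 2 + 8 * (κ : ℂ) ^ 4)) := by
      have := congrArg Complex.ofReal (hQ2 v)
      push_cast at this ⊢
      exact this
    rw [← h2, mul_pow, Complex.I_sq, h1, hP] at h3
    linear_combination -h3
  have hinj : ∀ v w, Y v < Y w → (Q v : ℂ) ≠ Q w := fun v w hvw heq ↦ by
    have h1 : Q v = Q w := by exact_mod_cast heq
    rw [hQ] at h1
    have h2 := h.one_sub_Y_pos v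
    have h3 := h.one_sub_Y_pos w
    have h4 : 0 < (1 - e) * (e + 2) ^ 2 / 9 := by
      have := h.e_pos
      have := h.e_lt_one
      have : 0 < 1 - e := by linarith
      positivity
    have h5 := div_lt_div_of_pos_left h4 h3 (by linarith : 1 - Y w < 1 - Y v)
    simp only at h1
    linarith
  obtain ⟨v₁, v₂, v₃, h12, h23⟩ := h.Y_values
  obtain ⟨ha, hb, hd⟩ := coeff_eq_zero_of_three_roots (hinj _ _ h12) (hinj _ _ h23)
    (hinj _ _ (h12.trans h23)) (key v₁) (key v₂) (key v₃)
  have hc0 : c = 0 := by linear_combination -ha / 12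
  subst hc0
  refine ⟨by linear_combination -hb, by linear_combination -hd, fun z hz ↦ ?_⟩
  rw [hc z hz, add_zero]

/-- On the real axis `Y` sits at the root `e`, so `℘` is a Möbius function of `X` with its pole at
`X = e`. The outer Möbius map is chosen so that the composite is the half-period involution of `X`.
-/
theorem weierstrassP_ofReal (h : IsOrbitPair e p q X X' Y Y')
    (hκ : ∀ z ∉ h.periodPair.lattice, kleinSum e X X' Y Y' z = ℘[h.periodPair] z) {u : ℝ}
    (hu : X u ≠ e) :
    1 - (1 - e) * (e + 2) ^ 2 / 9 / (℘[h.periodPair] u + 1 / 3) =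
      (e * (e + 3 - X u) / (2 * X u + e) : ℝ) := by
  have h0 : X u - e ≠ 0 := sub_ne_zero.2 hu
  have he := h.e_pos
  have he1 : 0 < 1 - e := by linarith [h.e_lt_one]
  have hX := h.le_X u
  have h1 : ℘[h.periodPair] u =
      (turningRate e / (X u - e) + (1 - 2 * e - 2 * e ^ 2) / 9 : ℝ) := by
    rw [← hκ u (h.notMem_lattice_of_X_ne (by simpa using hu)), kleinSum, Complex.ofReal_re,
      Complex.ofReal_im, h.Y_zero, h.Y'_zero, mul_zero, Complex.ofReal_zero, mul_zero, add_zero,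
      orbitPolar, turningRate]
    norm_cast
    field_simp
    ring
  have h2 : turningRate e / (X u - e) + (1 - 2 * e - 2 * e ^ 2) / 9 + 1 / 3 =
      (1 - e) * (e + 2) * (2 * X u + e) / (9 * (X u - e)) := by
    rw [turningRate]
    field_simp
    ring
  have h3 : (1 - e) * (e + 2) ^ 2 / 9 / (turningRate e / (X u - e) +
      (1 - 2 * e - 2 * e ^ 2) / 9 + 1 / 3) = (e + 2) * (X u - e) / (2 * X u + e) := by
    have : 0 < 2 * X u + e := by linarith
    rw [h2]
    field_simp
  have h4 : 1 - (1 - e) * (e + 2) ^ 2 / 9 / (turningRate e / (X u - e) +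
      (1 - 2 * e - 2 * e ^ 2) / 9 + 1 / 3) = e * (e + 3 - X u) / (2 * X u + e) := by
    have : 0 < 2 * X u + e := by linarith
    rw [h3]
    field_simp
    ring
  have h5 := congrArg Complex.ofReal h4
  rw [h1]
  push_cast at h5 ⊢
  exact h5

end IsOrbitPair

/-! ### Half-period translation, the meromorphic extension, and its periods. -/

theorem lipschitzOnWith_orbitForce {e : ℝ} : ∃ K : NNReal,
    LipschitzOnWith K (fun z : ℝ × ℝ ↦ (z.2, orbitForce e z.1)) (Set.Icc (-1) 1 ×ˢ Set.univ) := by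
  have h1 : ∃ K : NNReal, LipschitzOnWith K (orbitForce e) (Set.Icc (-1) 1) := by
    apply ContDiffOn.exists_lipschitzOnWith (n := 1) _ one_ne_zero (convex_Icc _ _) isCompact_Icc
    unfold orbitForce
    fun_prop
  obtain ⟨K, hK⟩ := h1
  refine ⟨max 1 (K * 1), LipschitzWith.prod_snd.lipschitzOnWith.prodMk
    (hK.comp LipschitzWith.prod_fst.lipschitzOnWith ?_)⟩
  intro z hz
  exact hz.1

theorem eq_of_int_mul_eq {x y : ℝ} (hx : 0 < x) (hy : 0 < y) {m n : ℤ} (h₁ : x = m * y)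
    (h₂ : y = n * x) : x = y := by
  have hm : (1 : ℝ) ≤ m := by
    have : (0 : ℝ) < m := by
      by_contra hm
      nlinarith
    exact_mod_cast this
  have hn : (1 : ℝ) ≤ n := by
    have : (0 : ℝ) < n := by
      by_contra hn
      nlinarith
    exact_mod_cast this
  nlinarith

theorem tendsto_ofReal_nhdsNE (x : ℝ) : Tendsto Complex.ofReal (𝓝[≠] x) (𝓝[≠] (x : ℂ)) :=
  Complex.continuous_ofReal.continuousAt.tendsto.inf
    (tendsto_principal_principal.2 fun _ h ↦ by simpa using h)

namespace IsOrbitPair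

variable {e p q : ℝ} {X X' Y Y' : ℝ → ℝ}

theorem two_X_add_pos (h : IsOrbitPair e p q X X' Y Y') (u : ℝ) : 0 < 2 * X u + e := by
  linarith [h.le_X u, h.e_pos]

/-- Translation by half a period acts on the motion by a Möbius involution. -/
theorem X_sub_half (h : IsOrbitPair e p q X X' Y Y') (u : ℝ) :
    X (u - p / 2) = e * (e + 3 - X u) / (2 * X u + e) := by
  obtain ⟨K, hK⟩ := lipschitzOnWith_orbitForce (e := e)
  have he := h.e_pos
  have key : (fun t ↦ (X (t - p / 2), X' (t - p / 2))) = fun t ↦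
      (e * (e + 3 - X t) / (2 * X t + e), -(3 * e * (e + 2) * X' t / (2 * X t + e) ^ 2)) := by
    refine ODE_solution_unique_univ (t₀ := 0)
      (v := fun _ z ↦ (z.2, orbitForce e z.1)) (s := fun _ ↦ Set.Icc (-1) 1 ×ˢ Set.univ)
      (fun _ ↦ hK) (fun t ↦ ⟨?_, ?_⟩) (fun t ↦ ⟨?_, ?_⟩) ?_
    · exact ((h.hasDerivAt_X _).comp_sub_const t (p / 2)).prodMk
        ((h.hasDerivAt_X' _).comp_sub_const t (p / 2))
    · exact ⟨⟨by linarith [h.le_X (t - p / 2)], h.X_le _⟩, trivial⟩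
    · have h0 := h.two_X_add_pos t
      have hd : HasDerivAt (fun t ↦ 2 * X t + e) (2 * X' t) t :=
        ((h.hasDerivAt_X t).const_mul 2).add_const e
      refine HasDerivAt.prodMk ?_ ?_
      · refine ((((h.hasDerivAt_X t).const_sub (e + 3)).const_mul e).div hd h0.ne').congr_deriv ?_
        field_simp
        ring
      · refine ((((h.hasDerivAt_X' t).const_mul (3 * e * (e + 2))).div (hd.pow 2)
          (pow_ne_zero 2 h0.ne')).neg).congr_deriv ?_
        -- The second derivative of the Möbius image contains `X'²`; the energy law makes it a
        -- function of `X` alone.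
        have hs := h.sq_X' t
        simp only [Nat.cast_ofNat, Nat.add_one_sub_one, pow_one, Pi.pow_apply]
        rw [show (3 * e * (e + 2) * orbitForce e (X t) * (2 * X t + e) ^ 2 -
          3 * e * (e + 2) * X' t * (2 * (2 * X t + e) * (2 * X' t))) =
          3 * e * (e + 2) * orbitForce e (X t) * (2 * X t + e) ^ 2 -
          3 * e * (e + 2) * 4 * (2 * X t + e) * X' t ^ 2 by ring, hs]
        simp only [orbitForce, orbitQuartic]
        field_simp
        ring
    · refine ⟨⟨?_, ?_⟩, trivial⟩
      · have h0 := h.two_X_add_pos t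
        have : 0 ≤ e * (e + 3 - X t) / (2 * X t + e) := by
          have := h.X_le t
          have : 0 ≤ e + 3 - X t := by linarith
          positivity
        linarith
      · change e * (e + 3 - X t) / (2 * X t + e) ≤ 1
        rw [div_le_one (h.two_X_add_pos t)]
        nlinarith [h.le_X t]
    -- The involution exchanges the turning points `e` and `1`, so the initial data agree, both at
    -- rest.
    · have h1 : X (0 - p / 2) = 1 := by rw [zero_sub, h.X_neg, h.X_half]
      have h2 : X' (0 - p / 2) = 0 := by rw [zero_sub, h.X'_neg, h.X'_half, neg_zero]
      simp only [h1, h2, h.X_zero, h.X'_zero]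
      congr 1
      · field_simp
        ring
      · simp
  exact congrArg Prod.fst (congrFun key u)

/-- The normal form of the meromorphic extension of the shifted motion `u ↦ X (u - p / 2)`. -/
noncomputable def extension (h : IsOrbitPair e p q X X' Y Y') : ℂ → ℂ :=
  toMeromorphicNFOn
    (fun z ↦ 1 - (1 - e) * (e + 2) ^ 2 / 9 / (℘[h.periodPair] z + 1 / 3)) Set.univ

theorem meromorphicNFOn_extension (h : IsOrbitPair e p q X X' Y Y') :
    MeromorphicNFOn h.extension Set.univ :=
  meromorphicNFOn_toMeromorphicNFOn _ _

theorem extension_eventuallyEq (h : IsOrbitPair e p q X X' Y Y') (x : ℂ) :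
    (fun z ↦ 1 - (1 - e) * (e + 2) ^ 2 / 9 / (℘[h.periodPair] z + 1 / 3)) =ᶠ[𝓝[≠] x]
      h.extension := by
  have hm : MeromorphicOn
      (fun z ↦ 1 - (1 - e) * (e + 2) ^ 2 / 9 / (℘[h.periodPair] z + 1 / 3)) Set.univ := by
    have := h.periodPair.meromorphicNFOn_weierstrassP.meromorphicOn
    exact (MeromorphicOn.const _).sub ((MeromorphicOn.const _).div (this.add (MeromorphicOn.const _)))
  exact (hm.toMeromorphicNFOn_eq_self_on_nhdsNE (Set.mem_univ x)).symm

theorem eventually_X_ne (h : IsOrbitPair e p q X X' Y Y') (x : ℝ) :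
    ∀ᶠ u in 𝓝[≠] x, X u ≠ e := by
  filter_upwards [(tendsto_ofReal_nhdsNE x).eventually
    (h.periodPair.eventually_notMem_lattice x)] with u hu he
  obtain ⟨n, rfl⟩ := h.X_eq u he
  exact hu (h.mem_lattice.2 ⟨n, 0, by simp⟩)

theorem extension_ofReal (h : IsOrbitPair e p q X X' Y Y')
    (hκ : ∀ z ∉ h.periodPair.lattice, kleinSum e X X' Y Y' z = ℘[h.periodPair] z) (x : ℝ) :
    h.extension x = X (x - p / 2) := by
  have h1 : Tendsto (fun u : ℝ ↦ h.extension u) (𝓝[≠] x) (𝓝 (X (x - p / 2) : ℂ)) := by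
    have hc : Continuous X := continuous_iff_continuousAt.2 fun u ↦ (h.hasDerivAt_X u).continuousAt
    have h2 : Tendsto (fun u : ℝ ↦ (X (u - p / 2) : ℂ)) (𝓝[≠] x) (𝓝 (X (x - p / 2) : ℂ)) := by
      have : Continuous (fun u : ℝ ↦ (X (u - p / 2) : ℂ)) := by fun_prop
      exact this.continuousAt.tendsto.mono_left nhdsWithin_le_nhds
    refine h2.congr' ?_
    filter_upwards [(tendsto_ofReal_nhdsNE x).eventually (h.extension_eventuallyEq x),
      h.eventually_X_ne x] with u hu hX
    rw [← hu, h.weierstrassP_ofReal hκ hX, h.X_sub_half]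
  have hnf := h.meromorphicNFOn_extension (Set.mem_univ (x : ℂ))
  -- Normal form leaves two cases: analytic, where the value is the limit along the real axis, or a
  -- pole, which that finite limit excludes.
  by_cases ho : 0 ≤ meromorphicOrderAt h.extension (x : ℂ)
  · have hA : AnalyticAt ℂ h.extension (x : ℂ) := hnf.meromorphicOrderAt_nonneg_iff_analyticAt.1 ho
    have h3 := (hA.continuousAt.tendsto.mono_left nhdsWithin_le_nhds).comp
      (tendsto_ofReal_nhdsNE x)
    exact tendsto_nhds_unique h3 h1
  · have h3 := (tendsto_cobounded_of_meromorphicOrderAt_neg (not_le.1 ho)).comp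
      (tendsto_ofReal_nhdsNE x)
    exact (h1.not_tendsto (Metric.disjoint_nhds_cobounded _) h3).elim

/-- The extension is an injective function of `℘` near every point, up to isolated exceptions.
Periods pass between the two near `0`, and then everywhere by the identity theorem for normal forms.
-/
theorem periodic_extension_iff (h : IsOrbitPair e p q X X' Y Y') {w : ℂ} :
    Function.Periodic h.extension w ↔ w ∈ h.periodPair.lattice := by
  have ht : Tendsto (fun z : ℂ ↦ z + w) (𝓝[≠] 0) (𝓝[≠] w) := by
    have h1 : Tendsto (fun z : ℂ ↦ z + w) (𝓝 0) (𝓝 w) := by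
      simpa using (continuous_add_const w).tendsto (0 : ℂ)
    exact h1.inf (tendsto_principal_principal.2 fun z hz ↦ by simpa using hz)
  have huniv : (Set.univ : Set ℂ) + ({w} : Set ℂ) = Set.univ := by
    rw [Set.add_singleton, Set.image_univ_of_surjective (add_right_surjective w)]
  have h0 := h.extension_eventuallyEq 0
  have hw := ht.eventually (h.extension_eventuallyEq w)
  refine ⟨fun hD ↦ h.periodPair.periodic_weierstrassP_iff.1 fun z ↦ ?_, fun hmem z ↦ ?_⟩
  · refine congrFun (MeromorphicNFOn.eq_of_frequently_eq (x := 0)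
      (meromorphicNFOn_fun_comp_add_const_iff_meromorphicNFOn.2
        (huniv.symm ▸ h.periodPair.meromorphicNFOn_weierstrassP))
      h.periodPair.meromorphicNFOn_weierstrassP (Eventually.frequently ?_)) z
    filter_upwards [h0, hw] with z h1 h2
    have he := h.e_pos
    have hc : ((1 - e) * (e + 2) ^ 2 / 9 : ℂ) ≠ 0 := by
      have : (1 - e) * (e + 2) ^ 2 / 9 ≠ 0 := by
        have := h.e_lt_one
        have : 0 < 1 - e := by linarith
        positivity
      rw [← Complex.ofReal_ne_zero] at this
      push_cast at this
      exact this
    rw [hD z, ← h1, sub_right_inj] at h2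
    simp only [div_eq_mul_inv] at h2 hc
    exact add_right_cancel (inv_injective (mul_left_cancel₀ hc h2))
  · refine congrFun (MeromorphicNFOn.eq_of_frequently_eq (x := 0)
      (meromorphicNFOn_fun_comp_add_const_iff_meromorphicNFOn.2
        (huniv.symm ▸ h.meromorphicNFOn_extension))
      h.meromorphicNFOn_extension (Eventually.frequently ?_)) z
    filter_upwards [h0, hw] with z h1 h2
    rw [← h1, ← h2, h.periodPair.periodic_weierstrassP_iff.2 hmem z]

/-- On each axis, the positive generators of the two descriptions are integer multiples of one
another, hence equal. -/
theorem isFundamentalHalfPeriods_iff (h : IsOrbitPair e p q X X' Y Y') {f : ℂ → ℂ}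
    (hf : ∀ w, Function.Periodic f w ↔ w ∈ h.periodPair.lattice) {ω ω' : ℂ} :
    IsFundamentalHalfPeriods f ω ω' ↔
      ω = (p / 2 : ℝ) ∧ ω' = Complex.I * (q / 2 : ℝ) := by
  have hp := h.p_pos
  have hq := h.q_pos
  simp only [IsFundamentalHalfPeriods, hf, h.mem_lattice]
  constructor
  · rintro ⟨⟨h1, h2⟩, ⟨h3, h4⟩, H⟩
    obtain ⟨a, b, hab⟩ := (H (2 * ω)).2 ⟨1, 0, by simp⟩
    obtain ⟨a', b', hab'⟩ := (H p).1 ⟨1, 0, by simp⟩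
    obtain ⟨c, d, hcd⟩ := (H (2 * ω')).2 ⟨0, 1, by simp⟩
    obtain ⟨c', d', hcd'⟩ := (H (q * Complex.I)).1 ⟨0, 1, by simp⟩
    have r1 := congrArg Complex.re hab
    have r2 := congrArg Complex.re hab'
    have r3 := congrArg Complex.im hcd
    have r4 := congrArg Complex.im hcd'
    simp [h2, h3] at r1 r2 r3 r4
    have e1 := eq_of_int_mul_eq (by linarith) hp r1 r2
    have e2 := eq_of_int_mul_eq (by linarith) hq r3 r4
    constructor <;> apply Complex.ext <;> simp [h2, h3] <;> linarith
  · rintro ⟨rfl, rfl⟩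
    refine ⟨⟨by simpa using hp, by simp⟩, ⟨by simp, by simpa using hq⟩, fun w ↦ ?_⟩
    refine exists₂_congr fun m n ↦ ?_
    rw [show (m : ℂ) * (2 * ((p / 2 : ℝ) : ℂ)) + n * (2 * (Complex.I * ((q / 2 : ℝ) : ℂ))) =
      m * p + n * (q * Complex.I) by push_cast; ring]

end IsOrbitPair

/-! ### Uniqueness of the two functions, and the conclusion. -/

theorem IsShenDn3.eq {κ : ℝ} {D E : ℂ → ℂ} (hD : IsShenDn3 κ D) (hE : IsShenDn3 κ E) : D = E := by
  refine hD.1.eq_of_frequently_eq hE.1 (x := (0 : ℝ)) ?_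
  exact (tendsto_ofReal_nhdsNE 0).frequently
    (Eventually.frequently (.of_forall fun u ↦ (hD.2 u).trans (hE.2 u).symm))

theorem IsShenP.eq {κ : ℝ} {f g : ℂ → ℂ} (hf : IsShenP κ f) (hg : IsShenP κ g) : f = g := by
  obtain ⟨L, h2, h3, rfl⟩ := hf
  obtain ⟨M, h2', h3', rfl⟩ := hg
  exact PeriodPair.weierstrassP_eq_of_invariants_eq (h2.trans h2'.symm) (h3.trans h3'.symm)

end

theorem theorem4 (κ : ℝ) (hκ₀ : 0 < κ) (hκ₁ : κ < 1) :
    (StrictMono (shenIntegral κ) ∧ Function.Surjective (shenIntegral κ) ∧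
      Differentiable ℝ (shenPhi κ)) ∧
    (∃! D : ℂ → ℂ, IsShenDn3 κ D) ∧
    (∃! p : ℂ → ℂ, IsShenP κ p) ∧
    ∀ f : ℂ → ℂ, (IsShenDn3 κ f ∨ IsShenP κ f) → ∀ ω ω' : ℂ,
      (IsFundamentalHalfPeriods f ω ω' ↔
        ω = ((Real.pi / 2 * ₂F₁ (1 / 3 : ℝ) (2 / 3 : ℝ) (1 : ℝ) (κ ^ 2 : ℝ) : ℝ) : ℂ) ∧
        ω' = Complex.I *
          ((√3 / 2 * Real.pi * ₂F₁ (1 / 3 : ℝ) (2 / 3 : ℝ) (1 : ℝ) (1 - κ ^ 2 : ℝ) : ℝ) : ℂ)) ∧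
      (IsFundamentalHalfPeriods f ω ω' →
        ω' / ω = Complex.I *
          ((√3 * (₂F₁ (1 / 3 : ℝ) (2 / 3 : ℝ) (1 : ℝ) (1 - κ ^ 2 : ℝ) /
            ₂F₁ (1 / 3 : ℝ) (2 / 3 : ℝ) (1 : ℝ) (κ ^ 2 : ℝ)) : ℝ) : ℂ)) := by
  obtain ⟨e, he, h⟩ := isOrbitPair hκ₀ hκ₁
  obtain ⟨hg₂, hg₃, hW⟩ := h.invariants he
  have hD : IsShenDn3 κ h.extension := ⟨h.meromorphicNFOn_extension, fun x ↦ by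
    rw [h.extension_ofReal hW, shenDelta_eq hκ₀ hκ₁]⟩
  have hP : IsShenP κ h.periodPair.weierstrassP := ⟨h.periodPair, hg₂, hg₃, rfl⟩
  refine ⟨⟨strictMono_shenIntegral hκ₀ hκ₁, surjective_shenIntegral hκ₀ hκ₁,
      fun u ↦ (hasDerivAt_shenPhi hκ₀ hκ₁ u).differentiableAt⟩,
    ⟨_, hD, fun D hD' ↦ hD'.eq hD⟩, ⟨_, hP, fun f hf ↦ hf.eq hP⟩, fun f hf ω ω' ↦ ?_⟩
  have hper : ∀ w, Function.Periodic f w ↔ w ∈ h.periodPair.lattice := by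
    rcases hf with hf | hf
    · rw [hf.eq hD]
      exact fun w ↦ h.periodic_extension_iff
    · rw [hf.eq hP]
      exact fun w ↦ h.periodPair.periodic_weierstrassP_iff
  have hκ : κ ^ 2 < 1 := by nlinarith
  have hp := orbitTime_zero_pi hκ₀ hκ₁
  have hq := orbitTime_pi_div_six_two_pi (m := √(1 - κ ^ 2)) (Real.sqrt_pos.2 (by linarith))
    ((Real.sqrt_lt' one_pos).2 (by nlinarith))
  rw [Real.sq_sqrt (by linarith)] at hq
  have hp₀ := h.p_pos
  -- Positivity is read off from the real period; it is needed to cancel in the period ratio.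
  have hF : 0 < ₂F₁ (1 / 3 : ℝ) (2 / 3 : ℝ) (1 : ℝ) (κ ^ 2 : ℝ) := by
    rw [hp] at hp₀
    exact (mul_pos_iff_of_pos_left Real.pi_pos).1 hp₀
  have key := h.isFundamentalHalfPeriods_iff hper (ω := ω) (ω' := ω')
  rw [hp, hq, mul_div_right_comm, mul_div_right_comm (√3 * Real.pi), mul_div_right_comm √3] at key
  refine ⟨key, fun hω ↦ ?_⟩
  obtain ⟨rfl, rfl⟩ := key.1 hω
  have hpi := Real.pi_ne_zero
  rw [mul_div_assoc, ← Complex.ofReal_div]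
  congr 2
  field_simp
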